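/- **Theorem (privacy of DP-SVRG++).** *Setting.* Let $\mathcal C\subseteq\mathbb R^p$ be a closed convex set, $\mathcal X$ a set, and $D=(z_1,\dots,z_n)\in\mathcal X^n$ a dataset, $n\ge 1$; two datasets are neighbours if they differ in at most one entry. Let $r$ be a real-valued function, convex and lower semicontinuous on $\mathcal C$. For every $z\in\mathcal X$ let $f(\cdot,z):\mathbb R^p\to\mathbb R$ be differentiable at every point of $\mathcal C$, with $|f(x,z)-f(y,z)|\le G\|x-y\|_2$ and $\|\nabla f(x,z)-\nabla f(y,z)\|_2\le L\|x-y\|_2$ for all $x,y\in\mathcal C$, where $G>0$. Write $F(x,D)=\frac1n\sum_{i=1}^n f(x,z_i)$ and $\mathrm{prox}_{\eta r}(y)=\arg\min_{x\in\mathcal C}\{\frac12\|x-y\|_2^2+\eta r(x)\}$. *Algorithm DP-SVRG++* with initial point $\tilde x_0\in\mathcal C$, step size $\eta>0$, integers $T\ge 0$, $m\ge 1$ and noise level $\sigma$: put $x_0^1=\tilde x_0$. For $s=1,\dots,T$ let $m_s=2^sm$; for $t=1,\dots,m_s$ draw $i_t^s$ uniformly from $\{1,\dots,n\}$ and $u_t^s\sim\mathcal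 N(0,\sigma^2I_p)$ (all draws independent) and set $$v_t^s=\nabla f(x_{t-1}^s,z_{i_t^s})-\nabla f(\tilde x_{s-1},z_{i_t^s})+\nabla F(\tilde x_{s-1},D)+u_t^s,\qquad x_t^s=\mathrm{prox}_{\eta r}(x_{t-1}^s-\eta v_t^s);$$ then set $\tilde x_s=\frac1{m_s}\sum_{k=1}^{m_s}x_k^s$ and $x_0^{s+1}=x_{m_s}^s$. The output is $\tilde x_T$. *Claim.* For every $A>0$ there are constants $c_1,c>0$, depending only on $A$, such that the following holds for all data as above and all $\epsilon,\delta>0$ with $\epsilon\le A\ln(2/\delta)$. If $$\epsilon\le c_1\frac{2^Tm}{n^2}\qquad\text{and}\qquad \sigma^2=c\,\frac{G^2\,2^Tm\,\ln(2/\delta)}{n^2\epsilon^2},$$ then DP-SVRG++ is $(\epsilon,\delta)$-differentially private: for all neighbouring $D,D'$ and every Borel set $S\subseteq\mathbb R^p$, $\Pr(\tilde x_T(D)\in S)\le e^\epsilon\Pr(\tilde x_T(D')\in S)+\delta$. -/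

import Mathlib

open MeasureTheory ProbabilityTheory

noncomputable section

namespace DPERM

/-- Two datasets of `n` records are neighbours if they differ in at most one entry. -/
def Neighbor {n : ℕ} {X : Type*} (D D' : Fin n → X) : Prop :=
  ∃ j, ∀ i, i ≠ j → D i = D' i

/-- `(ε, δ)`-differential privacy of a randomized algorithm. The algorithm uses a source of
randomness `(Ω, P)` and returns `A D ω` on the dataset `D` when the coins are `ω`. -/
def IsDP {n : ℕ} {X Ω O : Type*} [MeasurableSpace Ω] [MeasurableSpace O]
    (P : Measure Ω) (A : (Fin n → X) → Ω → O) (ε δ : ℝ) : Prop :=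
  ∀ D D' : Fin n → X, Neighbor D D' → ∀ S : Set O, MeasurableSet S →
    P {ω | A D ω ∈ S} ≤
      ENNReal.ofReal (Real.exp ε) * P {ω | A D' ω ∈ S} + ENNReal.ofReal δ

/-- Proximal operator of `r` over the constraint set `C`:
the minimizer over `w ∈ C` of `‖w - y‖² / 2 + r w`.
It exists and is unique when `C` is nonempty, closed and convex and `r` is convex and
lower semicontinuous on `C`; the value `y` in the other case is a placeholder. -/
def prox {p : ℕ} (C : Set (EuclideanSpace ℝ (Fin p))) (r : EuclideanSpace ℝ (Fin p) → ℝ)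
    (y : EuclideanSpace ℝ (Fin p)) : EuclideanSpace ℝ (Fin p) :=
  open Classical in
  if h : ∃ x ∈ C, IsMinOn (fun w => ‖w - y‖ ^ 2 / 2 + r w) C x then h.choose else y

/-- The gradient in `x` of the loss `f(x, z)`. -/
def lossGrad {p : ℕ} {X : Type*} (f : EuclideanSpace ℝ (Fin p) → X → ℝ)
    (x : EuclideanSpace ℝ (Fin p)) (z : X) : EuclideanSpace ℝ (Fin p) :=
  gradient (fun w => f w z) x

/-- `∇F(x, D) = (1/n) ∑ i, ∇f(x, z_i)`. -/
def riskGrad {p n : ℕ} {X : Type*} (f : EuclideanSpace ℝ (Fin p) → X → ℝ) (D : Fin n → X)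
    (x : EuclideanSpace ℝ (Fin p)) : EuclideanSpace ℝ (Fin p) :=
  (n : ℝ)⁻¹ • ∑ i, lossGrad f x (D i)

/-- The noisy variance-reduced gradient
`∇f(x, z_i) - ∇f(x̃, z_i) + ∇F(x̃, D) + u`, where `ξ = (i, u)` and `xt` is the snapshot `x̃`. -/
def noisyGrad {p n : ℕ} {X : Type*} (f : EuclideanSpace ℝ (Fin p) → X → ℝ) (D : Fin n → X)
    (xt x : EuclideanSpace ℝ (Fin p)) (ξ : Fin n × EuclideanSpace ℝ (Fin p)) :
    EuclideanSpace ℝ (Fin p) :=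
  lossGrad f x (D ξ.1) - lossGrad f xt (D ξ.1) + riskGrad f D xt + ξ.2

/-- The iterates `x_0, x_1, x_2, …` of one epoch with snapshot `xt` and starting point `x0`;
step `t` uses the coins `ξ t` (a sampled index and a noise vector), `t ≥ 1`. -/
def epochIter {p n : ℕ} {X : Type*} (f : EuclideanSpace ℝ (Fin p) → X → ℝ)
    (C : Set (EuclideanSpace ℝ (Fin p))) (r : EuclideanSpace ℝ (Fin p) → ℝ) (η : ℝ)
    (D : Fin n → X) (xt x0 : EuclideanSpace ℝ (Fin p))
    (ξ : ℕ → Fin n × EuclideanSpace ℝ (Fin p)) : ℕ → EuclideanSpace ℝ (Fin p)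
  | 0 => x0
  | t + 1 =>
    let x := epochIter f C r η D xt x0 ξ t
    prox C (fun w => η * r w) (x - η • noisyGrad f D xt x (ξ (t + 1)))

/-- The pair `(x̃_s, x_0^{s+1})` (snapshot, next starting point) after `s` epochs.
Epoch `s` has `2 ^ s * m` steps, and its step `t` uses the coins `ω (s, t)`. -/
def svrgppState {p n : ℕ} {X : Type*} (f : EuclideanSpace ℝ (Fin p) → X → ℝ)
    (C : Set (EuclideanSpace ℝ (Fin p))) (r : EuclideanSpace ℝ (Fin p) → ℝ) (η : ℝ) (m : ℕ)
    (xinit : EuclideanSpace ℝ (Fin p)) (D : Fin n → X)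
    (ω : ℕ × ℕ → Fin n × EuclideanSpace ℝ (Fin p)) :
    ℕ → EuclideanSpace ℝ (Fin p) × EuclideanSpace ℝ (Fin p)
  | 0 => (xinit, xinit)
  | s + 1 =>
    let prev := svrgppState f C r η m xinit D ω s
    let M : ℕ := 2 ^ (s + 1) * m
    let x := epochIter f C r η D prev.1 prev.2 (fun t => ω (s + 1, t))
    ((M : ℝ)⁻¹ • ∑ k ∈ Finset.Icc 1 M, x k, x M)

/-- The output `x̃_T` of DP-SVRG++ on the dataset `D` with coins `ω`. -/
def dpSvrgpp {p n : ℕ} {X : Type*} (f : EuclideanSpace ℝ (Fin p) → X → ℝ)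
    (C : Set (EuclideanSpace ℝ (Fin p))) (r : EuclideanSpace ℝ (Fin p) → ℝ) (η : ℝ) (T m : ℕ)
    (xinit : EuclideanSpace ℝ (Fin p)) (D : Fin n → X)
    (ω : ℕ × ℕ → Fin n × EuclideanSpace ℝ (Fin p)) : EuclideanSpace ℝ (Fin p) :=
  (svrgppState f C r η m xinit D ω T).1

/-- The law of the coins: for all `(s, t)` independently, a uniform index in `Fin n` and an
independent Gaussian noise vector with law `N(0, σ² I_p)`. -/
def coins (n p : ℕ) [NeZero n] (σ : ℝ) :
    Measure (ℕ × ℕ → Fin n × EuclideanSpace ℝ (Fin p)) :=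
  Measure.infinitePi fun _ =>
    (PMF.uniformOfFintype (Fin n)).toMeasure.prod
      (multivariateGaussian 0 (σ ^ 2 • (1 : Matrix (Fin p) (Fin p) ℝ)))

end DPERM

end

/-! Privacy is tracked through the Rényi divergence of a single order α, in the dual Hölder form
`DualClose`: E g(Z) ≤ B (E g(Z')^β)^(1/β) for all measurable g ≥ 0, with β conjugate to α. In this
form post-processing is immediate, adaptive composition multiplies the constants B
(`DualClose.step`), and indicator functions g yield approximate privacy (`DualClose.measure_le`). No
density of the law of the output is ever needed.

One step: given the current state, the noisy gradient is a uniform mixture of n Gaussians. Changing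
record j moves the j-th centre by O(G), and every other centre only by O(G/n), through the full
gradient at the snapshot. Sharing the j-th component equally among the others reduces the comparison
to two-point mixtures of weights 1 - 1/n and 1/n (`coinLaw_dual_le`). Their likelihood ratio R has
mean 1, and R - 1 is of order 1/n, so the first-order term of R^α integrates away and E R^α ≤
exp(O(α²G²/(n²σ²))) (`lintegral_ratio_rpow_le`). The Gaussian tails of the remainder are integrable
because αG²/σ² is small; this is the role of the upper bound on ε by c₁ 2^T m / n².

There are at most 2 · 2^T m steps. With α = 1 + 2 ln(2/δ)/ε and the prescribed σ, the total exponent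
E satisfies αE ≤ ln(2/δ), whence exp(αE - (α - 1)ε) ≤ δ/2.

One geometric point remains. The losses are Lipschitz on C only, so when C spans a proper subspace
the gradients may have large components orthogonal to it. The tangential component is bounded by G
(`norm_starProjection_gradient_le`), and the proximal map ignores the orthogonal one (`prox_congr`),
so the analysis can use projected gradients without changing the iterates. -/

noncomputable section

namespace DPERM

open scoped ENNReal NNReal RealInnerProductSpace

/-- The isotropic Gaussian law `N(0, v I)` on Euclidean space, as a product measure. -/
def isoGaussian (ι : Type*) [Fintype ι] (v : ℝ≥0) : Measure (EuclideanSpace ℝ ι) :=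
  (Measure.pi fun _ : ι => gaussianReal 0 v).map (WithLp.toLp 2)

/-! ### Isotropic Gaussians: translation and exponential moments. -/

section Gaussian

variable {ι : Type*} [Fintype ι]

instance (v : ℝ≥0) : IsProbabilityMeasure (isoGaussian ι v) :=
  Measure.isProbabilityMeasure_map (by fun_prop)

lemma charFun_isoGaussian (v : ℝ≥0) (t : EuclideanSpace ℝ ι) :
    charFun (isoGaussian ι v) t = Complex.exp (-(v * ‖t‖ ^ 2 / 2)) := by
  rw [isoGaussian, charFun_pi]
  simp_rw [charFun_gaussianReal, ← Complex.exp_sum, ← Complex.ofReal_pow,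
    EuclideanSpace.real_norm_sq_eq]
  simp [Finset.sum_div, Finset.mul_sum]

lemma multivariateGaussian_eq_isoGaussian [DecidableEq ι] (σ : ℝ) :
    multivariateGaussian 0 (σ ^ 2 • (1 : Matrix ι ι ℝ)) = isoGaussian ι (σ ^ 2).toNNReal := by
  apply Measure.ext_of_charFun
  ext t
  rw [charFun_multivariateGaussian, charFun_isoGaussian]
  · rw [Real.coe_toNNReal _ (sq_nonneg σ), ← Complex.ofReal_pow ‖t‖, EuclideanSpace.real_norm_sq_eq]
    congr 1
    rw [show t.ofLp ⬝ᵥ (σ ^ 2 • (1 : Matrix ι ι ℝ)).mulVec t.ofLp = σ ^ 2 * ∑ i, t i ^ 2 by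
      simp [Matrix.smul_mulVec, dotProduct, Finset.mul_sum, pow_two, mul_left_comm]]
    simp
  · exact Matrix.PosSemidef.one.smul (sq_nonneg σ)

lemma map_inner_isoGaussian (v : ℝ≥0) (x : EuclideanSpace ℝ ι) :
    (isoGaussian ι v).map (fun y => ⟪x, y⟫) = gaussianReal 0 (v * ‖x‖₊ ^ 2) := by
  have : IsProbabilityMeasure ((isoGaussian ι v).map (fun y => ⟪x, y⟫)) :=
    Measure.isProbabilityMeasure_map (by fun_prop)
  apply Measure.ext_of_charFun
  ext s
  rw [charFun_gaussianReal, charFun_apply_real, integral_map (by fun_prop) (by fun_prop)]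
  have h := charFun_isoGaussian v (s • x)
  rw [charFun_apply] at h
  calc _ = ∫ y, Complex.exp (⟪y, s • x⟫ * Complex.I) ∂(isoGaussian ι v) := by
        congr 1; ext y
        rw [real_inner_smul_right, real_inner_comm]; simp
    _ = _ := by
        rw [h, norm_smul]
        congr 1
        simp only [Complex.ofReal_mul, mul_pow, NNReal.coe_mul, NNReal.coe_pow, coe_nnnorm,
          Complex.ofReal_pow, Complex.ofReal_zero, mul_zero, zero_mul, zero_sub]
        rw [← Complex.ofReal_pow ‖s‖, Real.norm_eq_abs, sq_abs]
        push_cast; ring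

lemma gaussianReal_eq_withDensity {v : ℝ≥0} (hv : v ≠ 0) (a : ℝ) :
    gaussianReal a v = (gaussianReal 0 v).withDensity
      (fun y => ENNReal.ofReal (Real.exp (a * y / v - a ^ 2 / (2 * v)))) := by
  rw [gaussianReal_of_var_ne_zero _ hv, gaussianReal_of_var_ne_zero _ hv,
    ← withDensity_mul _ (measurable_gaussianPDF _ _) (by fun_prop)]
  congr 1
  ext y
  have hv' : (v : ℝ) ≠ 0 := by exact_mod_cast hv
  rw [Pi.mul_apply, gaussianPDF, gaussianPDF, ← ENNReal.ofReal_mul (gaussianPDFReal_nonneg _ _ _),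
    gaussianPDFReal, gaussianPDFReal, mul_assoc _ (Real.exp _), ← Real.exp_add]
  congr 3
  field_simp
  ring

/-- It suffices to compare on boxes, where the integral of the product density factorizes by
independence of the coordinates. -/
lemma pi_gaussianReal_eq_withDensity {v : ℝ≥0} (hv : v ≠ 0) (a : ι → ℝ) :
    (Measure.pi fun i => gaussianReal (a i) v) =
      (Measure.pi fun _ : ι => gaussianReal 0 v).withDensity
      (fun y => ∏ i, ENNReal.ofReal (Real.exp (a i * y i / v - a i ^ 2 / (2 * v)))) := by
  refine Measure.pi_eq ?_
  intro s hs
  rw [withDensity_apply _ (MeasurableSet.univ_pi hs), ← lintegral_indicator (MeasurableSet.univ_pi hs)]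
  have key := lintegral_prod_eq_prod_lintegral_of_indepFun (μ := Measure.pi fun _ : ι => gaussianReal 0 v)
    Finset.univ (fun i y => (s i).indicator
      (fun z => ENNReal.ofReal (Real.exp (a i * z / v - a i ^ 2 / (2 * v)))) (y i))
    (iIndepFun_pi (X := fun i => (s i).indicator
      (fun z => ENNReal.ofReal (Real.exp (a i * z / v - a i ^ 2 / (2 * v)))))
      (fun i => (Measurable.indicator (by fun_prop) (hs i)).aemeasurable))
    (fun i => (Measurable.indicator (by fun_prop) (hs i)).comp (measurable_pi_apply i))
  have e : ∀ y : ι → ℝ, (Set.pi Set.univ s).indicator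
      (fun y => ∏ i, ENNReal.ofReal (Real.exp (a i * y i / v - a i ^ 2 / (2 * v)))) y =
      ∏ i, (s i).indicator
      (fun z => ENNReal.ofReal (Real.exp (a i * z / v - a i ^ 2 / (2 * v)))) (y i) := by
    intro y
    by_cases hy : y ∈ Set.pi Set.univ s
    · rw [Set.indicator_of_mem hy]
      exact Finset.prod_congr rfl fun i _ => by rw [Set.indicator_of_mem (hy i trivial)]
    · rw [Set.indicator_of_notMem hy]
      simp only [Set.mem_pi, Set.mem_univ, true_imp_iff, not_forall] at hy
      obtain ⟨i, hi⟩ := hy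
      exact (Finset.prod_eq_zero (Finset.mem_univ i) (Set.indicator_of_notMem hi _)).symm
  simp_rw [e, key]
  refine Finset.prod_congr rfl fun i _ => ?_
  have hm : Measurable ((s i).indicator
      (fun z => ENNReal.ofReal (Real.exp (a i * z / v - a i ^ 2 / (2 * v))))) :=
    Measurable.indicator (by fun_prop) (hs i)
  have h1 := (measurePreserving_eval (fun _ : ι => gaussianReal 0 v) i).lintegral_comp hm
  simp only [Function.eval] at h1
  rw [h1, lintegral_indicator (hs i), gaussianReal_eq_withDensity hv (a i),
    withDensity_apply _ (hs i)]

/-- The log-likelihood ratio of `N(a, v I)` against `N(0, v I)`. -/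
def gaussLLR (v : ℝ≥0) (a y : EuclideanSpace ℝ ι) : ℝ := ⟪a, y⟫ / v - ‖a‖ ^ 2 / (2 * v)

@[fun_prop]
lemma measurable_gaussLLR (v : ℝ≥0) (a : EuclideanSpace ℝ ι) : Measurable (gaussLLR v a) := by
  unfold gaussLLR; fun_prop

/-- The Cameron–Martin formula. It puts all shifted Gaussians over one reference measure, where
mixtures can be compared pointwise. -/
lemma lintegral_isoGaussian_add {v : ℝ≥0} (hv : v ≠ 0) (a : EuclideanSpace ℝ ι)
    {g : EuclideanSpace ℝ ι → ℝ≥0∞} (hg : Measurable g) :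
    ∫⁻ y, g (a + y) ∂(isoGaussian ι v) =
      ∫⁻ y, ENNReal.ofReal (Real.exp (gaussLLR v a y)) * g y ∂(isoGaussian ι v) := by
  rw [isoGaussian, lintegral_map (by fun_prop) (by fun_prop),
    lintegral_map (by fun_prop) (by fun_prop)]
  have h1 : (Measure.pi fun _ : ι => gaussianReal 0 v).map (fun y i => a i + y i) =
      Measure.pi fun i => gaussianReal (a i) v := by
    rw [Measure.pi_map_pi (f := fun i x => a i + x) (fun i => by fun_prop)]
    congr 1; ext1 i
    rw [gaussianReal_map_const_add]; simp
  have h2 : ∫⁻ y, g (a + WithLp.toLp 2 y) ∂(Measure.pi fun _ : ι => gaussianReal 0 v) =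
      ∫⁻ y, g (WithLp.toLp 2 y) ∂((Measure.pi fun _ : ι => gaussianReal 0 v).map
        (fun y i => a i + y i)) := by
    rw [lintegral_map (by fun_prop) (by fun_prop)]
    rfl
  rw [h2, h1, pi_gaussianReal_eq_withDensity hv,
    lintegral_withDensity_eq_lintegral_mul _ (by fun_prop) (by fun_prop)]
  refine lintegral_congr fun y => ?_
  rw [Pi.mul_apply, ← ENNReal.ofReal_prod_of_nonneg (fun i _ => (Real.exp_pos _).le), ← Real.exp_sum]
  congr 3
  rw [gaussLLR, EuclideanSpace.real_norm_sq_eq, Finset.sum_sub_distrib, ← Finset.sum_div,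
    ← Finset.sum_div]
  congr 2
  rw [PiLp.inner_apply]
  simp [mul_comm]

/-- For w > 0 the integral equals (1 - w/2)^(-1/2), at most √2. The exponent 1/4 is what
`remainder_le` leaves to be integrated. -/
lemma lintegral_exp_sq_gaussianReal_le {w : ℝ≥0} (hw : w ≤ 1) :
    ∫⁻ x, ENNReal.ofReal (Real.exp (x ^ 2 / 4)) ∂(gaussianReal 0 w) ≤ 2 := by
  rcases eq_or_ne w 0 with rfl | h0
  · simp
  rw [gaussianReal_of_var_ne_zero _ h0, lintegral_withDensity_eq_lintegral_mul _
    (measurable_gaussianPDF _ _) (by fun_prop)]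
  have hw0 : 0 < (w : ℝ) := by positivity
  have hw1 : (w : ℝ) ≤ 1 := by exact_mod_cast hw
  set b : ℝ := 1 / (2 * w) - 1 / 4 with hb
  have hbpos : 0 < b := by
    have : 1 / 2 ≤ 1 / (2 * (w : ℝ)) := one_div_le_one_div_of_le (by positivity) (by linarith)
    linarith
  have e : ∀ x : ℝ, (gaussianPDF 0 w * fun x => ENNReal.ofReal (Real.exp (x ^ 2 / 4))) x =
      ENNReal.ofReal ((√(2 * Real.pi * w))⁻¹ * Real.exp (-b * x ^ 2)) := by
    intro x
    rw [Pi.mul_apply, gaussianPDF, ← ENNReal.ofReal_mul (gaussianPDFReal_nonneg _ _ _),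
      gaussianPDFReal, mul_assoc, ← Real.exp_add]
    congr 3
    rw [hb]; field_simp; ring
  simp_rw [e]
  rw [← ofReal_integral_eq_lintegral_ofReal ((integrable_exp_neg_mul_sq hbpos).const_mul _)
    (Filter.Eventually.of_forall fun x => by positivity), integral_const_mul, integral_gaussian]
  rw [← Real.sqrt_inv, ← Real.sqrt_mul (by positivity)]
  refine (ENNReal.ofReal_le_ofReal (q := 2) ?_).trans (by simp)
  refine Real.sqrt_le_iff.2 ⟨by norm_num, ?_⟩
  have : (2 * Real.pi * w)⁻¹ * (Real.pi / b) = 1 / (2 * w * b) := by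
    have := Real.pi_pos.ne'
    field_simp
  rw [this]
  have h2 : 2 * w * b = 1 - w / 2 := by rw [hb]; field_simp; ring
  rw [h2, div_le_iff₀ (by linarith)]
  linarith

lemma lintegral_exp_inner_sq_isoGaussian_le {v : ℝ≥0} {x : EuclideanSpace ℝ ι}
    (h : (v : ℝ) * ‖x‖ ^ 2 ≤ 1) :
    ∫⁻ y, ENNReal.ofReal (Real.exp (⟪x, y⟫ ^ 2 / 4)) ∂(isoGaussian ι v) ≤ 2 := by
  rw [← lintegral_map (μ := isoGaussian ι v) (g := fun y => ⟪x, y⟫)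
    (f := fun s : ℝ => ENNReal.ofReal (Real.exp (s ^ 2 / 4))) (by fun_prop) (by fun_prop),
    map_inner_isoGaussian]
  exact lintegral_exp_sq_gaussianReal_le (by exact_mod_cast h)

end Gaussian

/-! ### Pointwise bounds on powers of a likelihood ratio. -/

section ScalarBounds

lemma abs_exp_sub_exp_le {x y U : ℝ} (hx : x ≤ U) (hy : y ≤ U) :
    |Real.exp x - Real.exp y| ≤ |x - y| * Real.exp U := by
  have key : ∀ x y : ℝ, x ≤ U → Real.exp x - Real.exp y ≤ |x - y| * Real.exp U := by
    intro x y hx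
    have h1 := Real.add_one_le_exp (y - x)
    have h2 : Real.exp y = Real.exp (y - x) * Real.exp x := by rw [← Real.exp_add]; ring_nf
    calc Real.exp x - Real.exp y ≤ (x - y) * Real.exp x := by
          rw [h2]; nlinarith [Real.exp_pos x]
      _ ≤ |x - y| * Real.exp x := by gcongr; exact le_abs_self _
      _ ≤ _ := by gcongr
  rw [abs_le]
  constructor
  · have := key y x hy
    rw [abs_sub_comm] at this; linarith
  · exact key x y hx

lemma exp_le_of_nonpos {u : ℝ} (hu : u ≤ 0) : Real.exp u ≤ 1 + u + u ^ 2 := by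
  have h := Real.quadratic_le_exp_of_nonneg (x := -u) (by linarith)
  have h2 : Real.exp u * Real.exp (-u) = 1 := by rw [← Real.exp_add]; simp
  have h3 := Real.exp_pos u
  have h4 : Real.exp u * (1 - u + u ^ 2 / 2) ≤ 1 := by nlinarith
  have h5 : (1 : ℝ) ≤ (1 + u + u ^ 2) * (1 - u + u ^ 2 / 2) := by
    nlinarith [sq_nonneg u, sq_nonneg (u * u), mul_nonneg (sq_nonneg u) (neg_nonneg.2 hu)]
  have h6 : 0 < 1 - u + u ^ 2 / 2 := by nlinarith [sq_nonneg u]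
  nlinarith

lemma exp_le_of_nonneg {u : ℝ} (hu : 0 ≤ u) :
    Real.exp u ≤ 1 + u + u ^ 2 * Real.exp u := by
  have h1 := Real.add_one_le_exp (-u)
  have h2 : Real.exp u * Real.exp (-u) = 1 := by rw [← Real.exp_add]; simp
  have h3 := Real.exp_pos u
  nlinarith [mul_nonneg hu h3.le]

/-- Taylor expansion of exp(α log R), with log R ≤ R - 1. The factor exp(αΛ) is only needed when R ≥
1; for R < 1 the exponent α(R - 1) is negative and a plain quadratic suffices. -/
lemma rpow_le_quadratic {α R Λ : ℝ} (hα : 0 ≤ α) (hR : 0 < R) (hΛ : 0 ≤ Λ)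
    (hRΛ : Real.log R ≤ Λ) :
    R ^ α ≤ 1 + α * (R - 1) + α ^ 2 * (R - 1) ^ 2 * Real.exp (α * Λ) := by
  have hlog := Real.log_le_sub_one_of_pos hR
  rw [Real.rpow_def_of_pos hR]
  rcases le_or_gt 1 R with h | h
  · have h0 : 0 ≤ Real.log R := Real.log_nonneg h
    have h1 := exp_le_of_nonneg (u := Real.log R * α) (by positivity)
    have h2 : Real.log R * α ≤ α * (R - 1) := by nlinarith
    have h3 : (Real.log R * α) ^ 2 ≤ α ^ 2 * (R - 1) ^ 2 := by
      rw [← mul_pow]; exact pow_le_pow_left₀ (by positivity) h2 2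
    have h4 : Real.exp (Real.log R * α) ≤ Real.exp (α * Λ) := by
      rw [mul_comm]; gcongr
    calc _ ≤ _ := h1
      _ ≤ _ := by gcongr
  · have h1 : Real.exp (Real.log R * α) ≤ Real.exp (α * (R - 1)) := by
      rw [mul_comm]; gcongr
    have h2 := exp_le_of_nonpos (u := α * (R - 1)) (by nlinarith)
    have h3 : 1 ≤ Real.exp (α * Λ) := Real.one_le_exp (by positivity)
    have h4 : α ^ 2 * (R - 1) ^ 2 ≤ α ^ 2 * (R - 1) ^ 2 * Real.exp (α * Λ) :=
      le_mul_of_one_le_right (by positivity) h3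
    nlinarith

/-- Second-order bound on the powers of the likelihood ratio `R` of two two-point mixtures. -/
lemma mixture_ratio_rpow_le {q U la lb lb' α : ℝ} (hq : 0 < q) (hq2 : q ≤ 1 / 2)
    (ha : |la| ≤ q * U) (hb : |lb| ≤ U) (hb' : |lb'| ≤ U) (hα : 0 ≤ α) :
    ((((1 - q) * Real.exp la + q * Real.exp lb) / ((1 - q) + q * Real.exp lb')) ^ α) *
        ((1 - q) + q * Real.exp lb') + α * ((1 - q) + q * Real.exp lb') ≤
      ((1 - q) + q * Real.exp lb') + α * ((1 - q) * Real.exp la + q * Real.exp lb) +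
        25 * (α * q) ^ 2 * (U ^ 2 * Real.exp (3 * U + α * (15 * q * U + 2 * U ^ 2))) := by
  have hU : 0 ≤ U := (abs_nonneg _).trans hb
  set N := (1 - q) * Real.exp la + q * Real.exp lb with hN
  set D := (1 - q) + q * Real.exp lb' with hD
  have hDpos : 1 / 2 ≤ D := by have := Real.exp_pos lb'; nlinarith
  have hD0 : 0 < D := by linarith
  have hNpos : 0 < N := by
    have := Real.exp_pos lb; have := Real.exp_pos la
    have : 0 < 1 - q := by linarith
    positivity
  have h1U : 1 ≤ Real.exp U := Real.one_le_exp hU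
  have hqU : q * U ≤ U := by nlinarith
  have hDU : D ≤ Real.exp U := by
    have : Real.exp lb' ≤ Real.exp U := Real.exp_le_exp.2 ((le_abs_self _).trans hb')
    nlinarith
  have hNU : N ≤ Real.exp U := by
    have h1 : Real.exp lb ≤ Real.exp U := Real.exp_le_exp.2 ((le_abs_self _).trans hb)
    have h2 : Real.exp la ≤ Real.exp U := Real.exp_le_exp.2 ((le_abs_self _).trans (ha.trans hqU))
    nlinarith
  have hDL : Real.exp (-U) ≤ D := by
    have h1 : Real.exp (-U) ≤ Real.exp lb' := Real.exp_le_exp.2 (by linarith [neg_abs_le lb'])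
    have h2 : Real.exp (-U) ≤ 1 := Real.exp_le_one_iff.2 (by linarith)
    nlinarith
  -- Both differences are of order q: the first because |la| ≤ qU, the second because of its weight.
  -- The 5 is 1 + 4, from 1 - q ≤ D and 2 ≤ 4D.
  have habs : |N / D - 1| ≤ 5 * q * U * Real.exp U := by
    have e : N / D - 1 = ((1 - q) * (Real.exp la - Real.exp 0) + q * (Real.exp lb - Real.exp lb')) / D := by
      rw [div_sub_one hD0.ne', hN, hD, Real.exp_zero]; ring_nf
    have i1 : |Real.exp la - Real.exp 0| ≤ q * U * Real.exp U := by
      refine (abs_exp_sub_exp_le (U := U) ((le_abs_self _).trans (ha.trans hqU)) hU).trans ?_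
      rw [sub_zero]; gcongr
    have i2 : |Real.exp lb - Real.exp lb'| ≤ 2 * U * Real.exp U := by
      refine (abs_exp_sub_exp_le ((le_abs_self _).trans hb) ((le_abs_self _).trans hb')).trans ?_
      gcongr
      exact (abs_sub _ _).trans (by linarith)
    have i3 : |(1 - q) * (Real.exp la - Real.exp 0)| ≤ (1 - q) * (q * U * Real.exp U) := by
      rw [abs_mul, abs_of_nonneg (by linarith : 0 ≤ 1 - q)]
      exact mul_le_mul_of_nonneg_left i1 (by linarith)
    have i4 : |q * (Real.exp lb - Real.exp lb')| ≤ q * (2 * U * Real.exp U) := by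
      rw [abs_mul, abs_of_pos hq]; gcongr
    rw [e, abs_div, abs_of_pos hD0, div_le_iff₀ hD0]
    have i5 := abs_add_le ((1 - q) * (Real.exp la - Real.exp 0)) (q * (Real.exp lb - Real.exp lb'))
    have hE : 0 ≤ U * Real.exp U := by positivity
    have hqE : 0 ≤ q * (U * Real.exp U) := by positivity
    have i6 : (1 - q) * (q * U * Real.exp U) ≤ D * (q * (U * Real.exp U)) := by
      have : 1 - q ≤ D := by have := Real.exp_pos lb'; nlinarith
      nlinarith
    have i7 : q * (2 * U * Real.exp U) ≤ 4 * D * (q * (U * Real.exp U)) := by nlinarith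
    nlinarith
  have hRpos : 0 < N / D := by positivity
  -- For U ≤ 1 the previous bound gives 15qU, as e^U ≤ 3. For U > 1 the crude bound 2U is at most
  -- 2U². The quadratic term carries no factor q; it is what forces αM²/v to be small later.
  have hlog : Real.log (N / D) ≤ 15 * q * U + 2 * U ^ 2 := by
    rcases le_or_gt U 1 with h | h
    · have h1 := (Real.log_le_sub_one_of_pos hRpos).trans ((le_abs_self _).trans habs)
      have h2 : Real.exp U ≤ 3 := (Real.exp_le_exp.2 h).trans (by linarith [Real.exp_one_lt_d9])
      have h3 : 5 * q * U * Real.exp U ≤ 5 * q * U * 3 := by gcongr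
      nlinarith [sq_nonneg U]
    · have h1 : Real.log (N / D) ≤ 2 * U := by
        rw [Real.log_le_iff_le_exp hRpos, div_le_iff₀ hD0]
        calc N ≤ Real.exp U := hNU
          _ = Real.exp (2 * U) * Real.exp (-U) := by rw [← Real.exp_add]; ring_nf
          _ ≤ _ := by gcongr
      have : 0 ≤ q * U := by positivity
      nlinarith
  have hmain := rpow_le_quadratic hα hRpos (by positivity) hlog
  have hsq : (N / D - 1) ^ 2 ≤ (5 * q * U * Real.exp U) ^ 2 := sq_le_sq' (abs_le.1 habs).1 (abs_le.1 habs).2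
  have hlast : α ^ 2 * (N / D - 1) ^ 2 * Real.exp (α * (15 * q * U + 2 * U ^ 2)) * D ≤
      25 * (α * q) ^ 2 * (U ^ 2 * Real.exp (3 * U + α * (15 * q * U + 2 * U ^ 2))) := by
    calc _ ≤ α ^ 2 * (5 * q * U * Real.exp U) ^ 2 * Real.exp (α * (15 * q * U + 2 * U ^ 2)) * Real.exp U := by
          gcongr
      _ = _ := by
          have : Real.exp (3 * U + α * (15 * q * U + 2 * U ^ 2)) =
            Real.exp U ^ 3 * Real.exp (α * (15 * q * U + 2 * U ^ 2)) := by
            rw [Real.exp_add, ← Real.exp_nat_mul]; norm_num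
          rw [this]; ring
  have hmul := mul_le_mul_of_nonneg_right hmain hD0.le
  have e2 : (1 + α * (N / D - 1)) * D = D + α * N - α * D := by field_simp; ring
  nlinarith

lemma exp_add_three_le (x y z : ℝ) :
    Real.exp (x + y + z) ≤ Real.exp (3 * x) + Real.exp (3 * y) + Real.exp (3 * z) := by
  have hx := Real.exp_pos (3 * x)
  have hy := Real.exp_pos (3 * y)
  have hz := Real.exp_pos (3 * z)
  have : x + y + z ≤ 3 * x ∨ x + y + z ≤ 3 * y ∨ x + y + z ≤ 3 * z := by
    by_contra! h; linarith [h.1, h.2.1, h.2.2]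
  rcases this with h | h | h <;> have := Real.exp_le_exp.2 h <;> linarith

/-- With U = rW and W² ≤ e^(2W), everything except r² sits in one exponent. Completing squares
bounds it by three terms W²/144 plus constants: from the linear part 5W (leaving 900), from the term
with q (leaving 8100(αqr)²), and from 2αU² (by `hαr`). Since W² ≤ 4(x₁² + x₂² + x₃² + 1), a twelfth
of each square is left, and `exp_add_three_le` separates the variables. -/
lemma remainder_le {r α q x₁ x₂ x₃ U : ℝ} (hr1 : r ≤ 1) (hαr : α * r ^ 2 ≤ 1 / 288) (hU : U = r * (|x₁| + |x₂| + |x₃| + 1)) :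
    U ^ 2 * Real.exp (3 * U + α * (15 * q * U + 2 * U ^ 2)) ≤
      r ^ 2 * Real.exp (901 + 8100 * (α * q * r) ^ 2) *
        (Real.exp (x₁ ^ 2 / 4) + Real.exp (x₂ ^ 2 / 4) + Real.exp (x₃ ^ 2 / 4)) := by
  set W := |x₁| + |x₂| + |x₃| + 1 with hW
  have hW0 : 0 ≤ W := by positivity
  have h1 : W ^ 2 ≤ Real.exp (2 * W) := by
    have : W ≤ Real.exp W := by linarith [Real.add_one_le_exp W]
    calc W ^ 2 ≤ Real.exp W ^ 2 := by gcongr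
      _ = _ := by rw [← Real.exp_nat_mul]; norm_num
  have hW2 : W ^ 2 ≤ 4 * (x₁ ^ 2 + x₂ ^ 2 + x₃ ^ 2 + 1) := by
    rw [← sq_abs x₁, ← sq_abs x₂, ← sq_abs x₃, hW]
    nlinarith [sq_nonneg (|x₁| - |x₂|), sq_nonneg (|x₁| - |x₃|), sq_nonneg (|x₂| - |x₃|),
      sq_nonneg (|x₁| - 1), sq_nonneg (|x₂| - 1), sq_nonneg (|x₃| - 1)]
  have hexp : 2 * W + (3 * U + α * (15 * q * U + 2 * U ^ 2)) ≤
      (901 + 8100 * (α * q * r) ^ 2) + (x₁ ^ 2 / 12 + x₂ ^ 2 / 12 + x₃ ^ 2 / 12) := by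
    have e1 : U ≤ W := by rw [hU]; nlinarith
    have e2 : α * (2 * U ^ 2) ≤ W ^ 2 / 144 := by
      rw [hU]
      nlinarith [mul_le_mul_of_nonneg_right hαr (sq_nonneg W)]
    have e3 : α * (15 * q * U) ≤ W ^ 2 / 144 + 8100 * (α * q * r) ^ 2 := by
      rw [hU]; nlinarith [sq_nonneg (W / 12 - 90 * (α * q * r))]
    nlinarith [sq_nonneg (W / 12 - 30)]
  calc U ^ 2 * Real.exp (3 * U + α * (15 * q * U + 2 * U ^ 2))
      ≤ (r ^ 2 * Real.exp (2 * W)) * Real.exp (3 * U + α * (15 * q * U + 2 * U ^ 2)) := by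
        rw [show U ^ 2 = r ^ 2 * W ^ 2 by rw [hU]; ring]; gcongr
    _ = r ^ 2 * Real.exp (2 * W + (3 * U + α * (15 * q * U + 2 * U ^ 2))) := by
        rw [Real.exp_add (2 * W)]; ring
    _ ≤ r ^ 2 * Real.exp ((901 + 8100 * (α * q * r) ^ 2) +
          (x₁ ^ 2 / 12 + x₂ ^ 2 / 12 + x₃ ^ 2 / 12)) := by gcongr
    _ ≤ _ := by
        rw [Real.exp_add (901 + 8100 * (α * q * r) ^ 2), ← mul_assoc]
        have := exp_add_three_le (x₁ ^ 2 / 12) (x₂ ^ 2 / 12) (x₃ ^ 2 / 12)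
        rw [show 3 * (x₁ ^ 2 / 12) = x₁ ^ 2 / 4 by ring, show 3 * (x₂ ^ 2 / 12) = x₂ ^ 2 / 4 by ring,
          show 3 * (x₃ ^ 2 / 12) = x₃ ^ 2 / 4 by ring] at this
        gcongr

end ScalarBounds

/-- The constant in the Rényi bound for the mixtures of Gaussians. -/
def renyiConst : ℝ := 150 * Real.exp 901 + 8100

lemma renyiConst_pos : 0 < renyiConst := by unfold renyiConst; positivity

/-! ### Rényi moments of two-point Gaussian mixtures. -/

section Mixture

variable {ι : Type*} [Fintype ι]

lemma ofReal_mixture {q x y : ℝ} (hq : 0 ≤ q) (hq1 : q ≤ 1) (hx : 0 ≤ x) (hy : 0 ≤ y) :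
    ENNReal.ofReal ((1 - q) * x + q * y) =
      ENNReal.ofReal (1 - q) * ENNReal.ofReal x + ENNReal.ofReal q * ENNReal.ofReal y := by
  have : 0 ≤ 1 - q := by linarith
  rw [ENNReal.ofReal_add (by positivity) (by positivity), ENNReal.ofReal_mul this,
    ENNReal.ofReal_mul hq]

lemma lintegral_mixture_density {v : ℝ≥0} (hv : v ≠ 0) {q : ℝ} (hq : 0 ≤ q) (hq1 : q ≤ 1)
    (a b : EuclideanSpace ℝ ι) {g : EuclideanSpace ℝ ι → ℝ≥0∞} (hg : Measurable g) :
    ∫⁻ y, ENNReal.ofReal ((1 - q) * Real.exp (gaussLLR v a y) + q * Real.exp (gaussLLR v b y)) * g y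
        ∂(isoGaussian ι v) =
      ENNReal.ofReal (1 - q) * ∫⁻ y, g (a + y) ∂(isoGaussian ι v) +
        ENNReal.ofReal q * ∫⁻ y, g (b + y) ∂(isoGaussian ι v) := by
  simp_rw [ofReal_mixture hq hq1 (Real.exp_pos _).le (Real.exp_pos _).le]
  rw [lintegral_isoGaussian_add hv a hg, lintegral_isoGaussian_add hv b hg,
    ← lintegral_const_mul _ (by fun_prop), ← lintegral_const_mul _ (by fun_prop),
    ← lintegral_add_left (by fun_prop)]
  refine lintegral_congr fun y => ?_
  ring

lemma gaussLLR_zero (v : ℝ≥0) (y : EuclideanSpace ℝ ι) : gaussLLR v 0 y = 0 := by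
  simp [gaussLLR]

/-- The Rényi moment of two two-point Gaussian mixtures, one of whose centres is the origin. -/
lemma lintegral_ratio_rpow_le {v : ℝ≥0} {q M α : ℝ} (hM : 0 < M) (hMv : M ^ 2 ≤ v)
    (hq : 0 < q) (hq2 : q ≤ 1 / 2) (hα : 0 ≤ α) (hαv : α * (M ^ 2 / v) ≤ 1 / 288)
    {a b b' : EuclideanSpace ℝ ι} (ha : ‖a‖ ≤ q * M) (hb : ‖b‖ ≤ M) (hb' : ‖b'‖ ≤ M) :
    ∫⁻ y, ENNReal.ofReal (((((1 - q) * Real.exp (gaussLLR v a y) + q * Real.exp (gaussLLR v b y)) /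
        ((1 - q) + q * Real.exp (gaussLLR v b' y))) ^ α) *
        ((1 - q) + q * Real.exp (gaussLLR v b' y))) ∂(isoGaussian ι v) ≤
      ENNReal.ofReal (Real.exp (renyiConst * (α * q) ^ 2 * (M ^ 2 / v))) := by
  have hv0 : 0 < (v : ℝ) := lt_of_lt_of_le (by positivity) hMv
  have hv : v ≠ 0 := by rintro rfl; simp at hv0
  set r : ℝ := M / √v with hr
  have hsv : 0 < √(v : ℝ) := Real.sqrt_pos.2 hv0
  have hs2 : √(v : ℝ) ^ 2 = v := Real.sq_sqrt hv0.le
  have hr2 : r ^ 2 = M ^ 2 / v := by rw [hr, div_pow, hs2]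
  have hr0 : 0 < r := by positivity
  have hr1 : r ≤ 1 := by
    rw [hr, div_le_one hsv]; exact Real.le_sqrt_of_sq_le hMv
  -- normalised directions
  have hdir : ∀ (R : ℝ) (x : EuclideanSpace ℝ ι), 0 < R → ‖x‖ ≤ R →
      (v : ℝ) * ‖(1 / (R * √v)) • x‖ ^ 2 ≤ 1 := by
    intro R x hR hx
    rw [norm_smul, Real.norm_of_nonneg (by positivity), mul_pow, div_pow, mul_pow, hs2]
    have : ‖x‖ ^ 2 ≤ R ^ 2 := by gcongr
    rw [one_pow, one_div, mul_inv, show (v : ℝ) * ((R ^ 2)⁻¹ * (v : ℝ)⁻¹ * ‖x‖ ^ 2) =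
      ‖x‖ ^ 2 / R ^ 2 by field_simp]
    exact div_le_one_of_le₀ this (by positivity)
  have hllr : ∀ (R : ℝ) (x y : EuclideanSpace ℝ ι), 0 < R → ‖x‖ ≤ R →
      |gaussLLR v x y| ≤ R / √v * |⟪(1 / (R * √v)) • x, y⟫| + (R / √v) ^ 2 := by
    intro R x y hR hx
    have e1 : ⟪x, y⟫ / v = R / √v * ⟪(1 / (R * √v)) • x, y⟫ := by
      rw [real_inner_smul_left]; nth_rw 1 [← hs2]; field_simp
    rw [gaussLLR, e1]
    refine (abs_sub _ _).trans ?_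
    rw [abs_mul, abs_of_pos (by positivity : 0 < R / √(v : ℝ)),
      abs_of_nonneg (by positivity : 0 ≤ ‖x‖ ^ 2 / (2 * (v : ℝ)))]
    gcongr
    rw [div_pow, hs2]
    have : ‖x‖ ^ 2 ≤ R ^ 2 := by gcongr
    rw [div_le_div_iff₀ (by positivity) hv0]
    nlinarith [mul_le_mul_of_nonneg_right this hv0.le, mul_nonneg (sq_nonneg R) hv0.le]
  set X₁ := (1 / (q * M * √v)) • a with hX₁
  set X₂ := (1 / (M * √v)) • b with hX₂
  set X₃ := (1 / (M * √v)) • b' with hX₃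
  set E : EuclideanSpace ℝ ι → ℝ := fun y =>
    Real.exp (⟪X₁, y⟫ ^ 2 / 4) + Real.exp (⟪X₂, y⟫ ^ 2 / 4) + Real.exp (⟪X₃, y⟫ ^ 2 / 4) with hE
  have hEint : ∫⁻ y, ENNReal.ofReal (E y) ∂(isoGaussian ι v) ≤ ENNReal.ofReal 6 := by
    simp_rw [hE]
    have e : ∀ y, ENNReal.ofReal (Real.exp (⟪X₁, y⟫ ^ 2 / 4) + Real.exp (⟪X₂, y⟫ ^ 2 / 4) +
        Real.exp (⟪X₃, y⟫ ^ 2 / 4)) = ENNReal.ofReal (Real.exp (⟪X₁, y⟫ ^ 2 / 4)) +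
        ENNReal.ofReal (Real.exp (⟪X₂, y⟫ ^ 2 / 4)) +
        ENNReal.ofReal (Real.exp (⟪X₃, y⟫ ^ 2 / 4)) := fun y => by
      rw [ENNReal.ofReal_add (by positivity) (by positivity),
        ENNReal.ofReal_add (by positivity) (by positivity)]
    simp_rw [e]
    rw [lintegral_add_left (by fun_prop), lintegral_add_left (by fun_prop)]
    have h1 := lintegral_exp_inner_sq_isoGaussian_le (hdir (q * M) a (by positivity) ha)
    have h2 := lintegral_exp_inner_sq_isoGaussian_le (hdir M b hM hb)
    have h3 := lintegral_exp_inner_sq_isoGaussian_le (hdir M b' hM hb')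
    calc _ ≤ (2 : ℝ≥0∞) + 2 + 2 := add_le_add (add_le_add h1 h2) h3
      _ = _ := by rw [show (6 : ℝ) = 2 + 2 + 2 by norm_num]; simp [ENNReal.ofReal_add]
  set K : ℝ := 25 * (α * q) ^ 2 * (r ^ 2 * Real.exp (901 + 8100 * (α * q * r) ^ 2)) with hK
  have hK0 : 0 ≤ K := by positivity
  -- the pointwise bound
  have hpt : ∀ y, ENNReal.ofReal (((((1 - q) * Real.exp (gaussLLR v a y) +
        q * Real.exp (gaussLLR v b y)) / ((1 - q) + q * Real.exp (gaussLLR v b' y))) ^ α) *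
        ((1 - q) + q * Real.exp (gaussLLR v b' y))) +
        ENNReal.ofReal α * ENNReal.ofReal ((1 - q) * Real.exp (gaussLLR v 0 y) +
          q * Real.exp (gaussLLR v b' y)) ≤
      ENNReal.ofReal ((1 - q) * Real.exp (gaussLLR v 0 y) + q * Real.exp (gaussLLR v b' y)) +
      ENNReal.ofReal α * ENNReal.ofReal ((1 - q) * Real.exp (gaussLLR v a y) +
        q * Real.exp (gaussLLR v b y)) + ENNReal.ofReal K * ENNReal.ofReal (E y) := by
    intro y
    have h1q : 0 ≤ 1 - q := by linarith
    set U := r * (|⟪X₁, y⟫| + |⟪X₂, y⟫| + |⟪X₃, y⟫| + 1) with hU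
    have hrr : r ^ 2 ≤ r := by nlinarith
    have hb1 : |gaussLLR v b y| ≤ U := by
      have := hllr M b y hM hb
      rw [← hX₂, ← hr] at this
      have i1 : 0 ≤ r * |⟪X₁, y⟫| := by positivity
      have i3 : 0 ≤ r * |⟪X₃, y⟫| := by positivity
      rw [hU]; linarith
    have hb2 : |gaussLLR v b' y| ≤ U := by
      have := hllr M b' y hM hb'
      rw [← hX₃, ← hr] at this
      have i1 : 0 ≤ r * |⟪X₁, y⟫| := by positivity
      have i3 : 0 ≤ r * |⟪X₂, y⟫| := by positivity
      rw [hU]; linarith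
    have hb3 : |gaussLLR v a y| ≤ q * U := by
      have := hllr (q * M) a y (by positivity) ha
      rw [← hX₁, mul_div_assoc, ← hr] at this
      have i1 : 0 ≤ q * (r * |⟪X₂, y⟫|) := by positivity
      have i3 : 0 ≤ q * (r * |⟪X₃, y⟫|) := by positivity
      have i4 : (q * r) ^ 2 ≤ q * r := by
        have : q * r ≤ 1 := by nlinarith
        nlinarith [mul_nonneg hq.le hr0.le]
      rw [hU]; linarith
    have h1 := mixture_ratio_rpow_le hq hq2 hb3 hb1 hb2 hα
    have h2 := remainder_le (q := q) hr1 (by rw [hr2]; exact hαv) hU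
    have h3 : 25 * (α * q) ^ 2 * (U ^ 2 * Real.exp (3 * U + α * (15 * q * U + 2 * U ^ 2))) ≤
        K * E y := by
      calc _ ≤ _ := mul_le_mul_of_nonneg_left h2 (by positivity)
        _ = _ := by rw [hK, hE]; ring
    rw [gaussLLR_zero, Real.exp_zero, mul_one, ← ENNReal.ofReal_mul hα, ← ENNReal.ofReal_mul hα,
      ← ENNReal.ofReal_mul hK0, ← ENNReal.ofReal_add (by positivity) (by positivity),
      ← ENNReal.ofReal_add (by positivity) (by positivity),
      ← ENNReal.ofReal_add (by positivity) (by positivity)]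
    exact ENNReal.ofReal_le_ofReal (by linarith)
  -- Both mixtures are probability densities, so after integration the two terms with coefficient α
  -- in `hpt` are equal and finite, and cancel.
  have hone : ∀ c d : EuclideanSpace ℝ ι, ∫⁻ y, ENNReal.ofReal ((1 - q) * Real.exp (gaussLLR v c y) +
        q * Real.exp (gaussLLR v d y)) ∂(isoGaussian ι v) = 1 := by
    intro c d
    have := lintegral_mixture_density hv hq.le (by linarith : q ≤ 1) c d (g := fun _ => 1)
      measurable_const
    simp only [mul_one, lintegral_const, measure_univ] at this
    rw [this, ← ENNReal.ofReal_add (by linarith) hq.le]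
    simp
  have hint := lintegral_mono (μ := isoGaussian ι v) hpt
  rw [lintegral_add_right _ (by fun_prop), lintegral_add_left (by fun_prop),
    lintegral_add_left (by fun_prop), lintegral_const_mul _ (by fun_prop),
    lintegral_const_mul _ (by fun_prop), lintegral_const_mul _ (by fun_prop), hone, hone, mul_one,
    add_right_comm] at hint
  have hint2 := (ENNReal.add_le_add_iff_right ENNReal.ofReal_ne_top).1 hint
  refine hint2.trans ?_
  calc (1 : ℝ≥0∞) + ENNReal.ofReal K * ∫⁻ y, ENNReal.ofReal (E y) ∂(isoGaussian ι v)
      ≤ 1 + ENNReal.ofReal K * ENNReal.ofReal 6 := by gcongr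
    _ = ENNReal.ofReal (1 + K * 6) := by
        rw [ENNReal.ofReal_add (by norm_num) (by positivity), ENNReal.ofReal_mul hK0,
          ENNReal.ofReal_one]
    _ ≤ _ := by
        apply ENNReal.ofReal_le_ofReal
        -- With a = 150 e^901 t and b = 8100 t, 1 + a e^b ≤ (1 + a) e^b ≤ e^(a + b). This fixes
        -- `renyiConst`, and no smallness of αqr is required.
        set t := (α * q * r) ^ 2 with ht
        have e1 : renyiConst * (α * q) ^ 2 * (M ^ 2 / v) = 150 * Real.exp 901 * t + 8100 * t := by
          rw [renyiConst, ← hr2, ht]; ring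
        have e2 : K * 6 = (150 * Real.exp 901 * t) * Real.exp (8100 * t) := by
          rw [hK, Real.exp_add, ht]; ring
        have ht0 : 0 ≤ t := by positivity
        rw [e1, e2, Real.exp_add]
        have h1 : 1 ≤ Real.exp (8100 * t) := Real.one_le_exp (by positivity)
        have h2 := Real.add_one_le_exp (150 * Real.exp 901 * t)
        calc _ ≤ (150 * Real.exp 901 * t + 1) * Real.exp (8100 * t) := by linarith
          _ ≤ _ := by gcongr

/-- Rényi bound, in dual (Hölder) form, for two two-point Gaussian mixtures. -/
lemma mixture_dual_le_of_zero {v : ℝ≥0} {q M α β : ℝ} (hM : 0 < M) (hMv : M ^ 2 ≤ v)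
    (hq : 0 < q) (hq2 : q ≤ 1 / 2) (hαβ : α.HolderConjugate β)
    (hαv : α * (M ^ 2 / v) ≤ 1 / 288)
    {a b b' : EuclideanSpace ℝ ι} (ha : ‖a‖ ≤ q * M) (hb : ‖b‖ ≤ M) (hb' : ‖b'‖ ≤ M)
    {g : EuclideanSpace ℝ ι → ℝ≥0∞} (hg : Measurable g) :
    ENNReal.ofReal (1 - q) * ∫⁻ y, g (a + y) ∂(isoGaussian ι v) +
        ENNReal.ofReal q * ∫⁻ y, g (b + y) ∂(isoGaussian ι v) ≤
      ENNReal.ofReal (Real.exp (renyiConst * α * q ^ 2 * (M ^ 2 / v))) *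
        (ENNReal.ofReal (1 - q) * ∫⁻ y, g y ^ β ∂(isoGaussian ι v) +
        ENNReal.ofReal q * ∫⁻ y, g (b' + y) ^ β ∂(isoGaussian ι v)) ^ (1 / β) := by
  have hv0 : 0 < (v : ℝ) := lt_of_lt_of_le (by positivity) hMv
  have hv : v ≠ 0 := by rintro rfl; simp at hv0
  have hα : 0 < α := hαβ.pos
  have hq1 : q ≤ 1 := by linarith
  set γ := isoGaussian ι v
  set N : EuclideanSpace ℝ ι → ℝ := fun y =>
    (1 - q) * Real.exp (gaussLLR v a y) + q * Real.exp (gaussLLR v b y) with hN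
  set D : EuclideanSpace ℝ ι → ℝ := fun y => (1 - q) + q * Real.exp (gaussLLR v b' y) with hD
  have hD0 : ∀ y, 0 < D y := fun y => by
    have : 0 < 1 - q := by linarith
    positivity
  have hN0 : ∀ y, 0 < N y := fun y => by
    have : 0 < 1 - q := by linarith
    positivity
  have hNm : Measurable N := by fun_prop
  have hDm : Measurable D := by fun_prop
  set μ := γ.withDensity (fun y => ENNReal.ofReal (D y)) with hμ
  have hD' : ∀ y, D y = (1 - q) * Real.exp (gaussLLR v 0 y) + q * Real.exp (gaussLLR v b' y) :=
    fun y => by simp [hD, gaussLLR_zero]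
  have hμβ : ∫⁻ y, g y ^ β ∂μ = ENNReal.ofReal (1 - q) * ∫⁻ y, g y ^ β ∂γ +
      ENNReal.ofReal q * ∫⁻ y, g (b' + y) ^ β ∂γ := by
    have := lintegral_mixture_density hv hq.le hq1 0 b' (g := fun y => g y ^ β) (by fun_prop)
    simp only [zero_add] at this
    rw [hμ, lintegral_withDensity_eq_lintegral_mul _ (by fun_prop) (by fun_prop), ← this]
    refine lintegral_congr fun y => ?_
    rw [Pi.mul_apply, hD']
  have hμα : ∫⁻ y, ENNReal.ofReal (N y / D y) ^ α ∂μ ≤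
      ENNReal.ofReal (Real.exp (renyiConst * (α * q) ^ 2 * (M ^ 2 / v))) := by
    rw [hμ, lintegral_withDensity_eq_lintegral_mul _ (by fun_prop) (by fun_prop)]
    refine le_of_eq_of_le (lintegral_congr fun y => ?_)
      (lintegral_ratio_rpow_le hM hMv hq hq2 hα.le hαv ha hb hb')
    rw [Pi.mul_apply, ENNReal.ofReal_rpow_of_pos (div_pos (hN0 y) (hD0 y)),
      ← ENNReal.ofReal_mul (hD0 y).le, mul_comm]
  rw [← lintegral_mixture_density hv hq.le hq1 a b hg, ← hμβ]
  -- Hölder's inequality with respect to the second mixture, applied to the likelihood ratio N/D and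
  -- g. The 1/α-th power then turns α² into α in the exponent.
  calc ∫⁻ y, ENNReal.ofReal (N y) * g y ∂γ
      = ∫⁻ y, ((fun y => ENNReal.ofReal (N y / D y)) * g) y ∂μ := by
        rw [hμ, lintegral_withDensity_eq_lintegral_mul _ (by fun_prop) (by fun_prop)]
        refine lintegral_congr fun y => ?_
        rw [Pi.mul_apply, Pi.mul_apply, ← mul_assoc, ← ENNReal.ofReal_mul (hD0 y).le,
          mul_div_cancel₀ _ (hD0 y).ne']
    _ ≤ (∫⁻ y, ENNReal.ofReal (N y / D y) ^ α ∂μ) ^ (1 / α) * (∫⁻ y, g y ^ β ∂μ) ^ (1 / β) :=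
        ENNReal.lintegral_mul_le_Lp_mul_Lq μ hαβ (by fun_prop) hg.aemeasurable
    _ ≤ _ := by
        gcongr
        calc _ ≤ (ENNReal.ofReal (Real.exp (renyiConst * (α * q) ^ 2 * (M ^ 2 / v)))) ^ (1 / α) := by
              gcongr
          _ = _ := by
              rw [ENNReal.ofReal_rpow_of_pos (Real.exp_pos _), ← Real.exp_mul]
              congr 2
              field_simp

/-- Rényi bound, in dual (Hölder) form, for two two-point Gaussian mixtures. -/
lemma mixture_dual_le {v : ℝ≥0} {q M α β : ℝ} (hM : 0 < M) (hMv : M ^ 2 ≤ v)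
    (hq : 0 < q) (hq2 : q ≤ 1 / 2) (hαβ : α.HolderConjugate β)
    (hαv : α * (M ^ 2 / v) ≤ 1 / 288)
    {a a' b b' : EuclideanSpace ℝ ι} (ha : ‖a - a'‖ ≤ q * M) (hb : ‖b - a'‖ ≤ M)
    (hb' : ‖b' - a'‖ ≤ M) {g : EuclideanSpace ℝ ι → ℝ≥0∞} (hg : Measurable g) :
    ENNReal.ofReal (1 - q) * ∫⁻ y, g (a + y) ∂(isoGaussian ι v) +
        ENNReal.ofReal q * ∫⁻ y, g (b + y) ∂(isoGaussian ι v) ≤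
      ENNReal.ofReal (Real.exp (renyiConst * α * q ^ 2 * (M ^ 2 / v))) *
        (ENNReal.ofReal (1 - q) * ∫⁻ y, g (a' + y) ^ β ∂(isoGaussian ι v) +
        ENNReal.ofReal q * ∫⁻ y, g (b' + y) ^ β ∂(isoGaussian ι v)) ^ (1 / β) := by
  have := mixture_dual_le_of_zero hM hMv hq hq2 hαβ hαv ha hb hb'
    (g := fun y => g (a' + y)) (by fun_prop)
  simpa only [← add_assoc, add_sub_cancel] using this

end Mixture

/-! ### From two-point mixtures to a uniformly sampled index. -/

section Subsampling

variable {ι : Type*} [Fintype ι]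

/-- The law of one coin: a uniform index and an independent isotropic Gaussian vector. -/
def coinLaw (n : ℕ) [NeZero n] (ι : Type*) [Fintype ι] (v : ℝ≥0) :
    Measure (Fin n × EuclideanSpace ℝ ι) :=
  (PMF.uniformOfFintype (Fin n)).toMeasure.prod (isoGaussian ι v)

instance (n : ℕ) [NeZero n] (v : ℝ≥0) : IsProbabilityMeasure (coinLaw n ι v) := by
  unfold coinLaw; infer_instance

lemma lintegral_coinLaw (n : ℕ) [NeZero n] (v : ℝ≥0) (μ : Fin n → EuclideanSpace ℝ ι)
    {g : EuclideanSpace ℝ ι → ℝ≥0∞} (hg : Measurable g) :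
    ∫⁻ ξ, g (μ ξ.1 + ξ.2) ∂(coinLaw n ι v) =
      ENNReal.ofReal (1 / n) * ∑ i, ∫⁻ y, g (μ i + y) ∂(isoGaussian ι v) := by
  have hμ : Measurable μ := measurable_of_countable μ
  rw [coinLaw, lintegral_prod _ (by fun_prop), lintegral_fintype, Finset.mul_sum]
  refine Finset.sum_congr rfl fun i _ => ?_
  rw [PMF.toMeasure_apply_singleton _ _ (measurableSet_singleton i), PMF.uniformOfFintype_apply,
    mul_comm, Fintype.card_fin, one_div, ENNReal.ofReal_inv_of_pos (by exact_mod_cast NeZero.pos n),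
    ENNReal.ofReal_natCast]

/-- Jensen's inequality for the concave power 1/β. It makes the dual bound stable under averaging of
pairs of laws. -/
lemma sum_mul_rpow_inv_le {κ : Type*} (s : Finset κ) (w A : κ → ℝ≥0∞) (hw : ∑ i ∈ s, w i = 1)
    {β : ℝ} (hβ : 1 ≤ β) :
    ∑ i ∈ s, w i * A i ^ (1 / β) ≤ (∑ i ∈ s, w i * A i) ^ (1 / β) := by
  have hβ0 : 0 < β := by linarith
  have h := ENNReal.rpow_arith_mean_le_arith_mean_rpow s w (fun i => A i ^ (1 / β)) hw hβ
  have e : ∀ i, (A i ^ (1 / β)) ^ β = A i := fun i => by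
    rw [← ENNReal.rpow_mul, one_div, inv_mul_cancel₀ hβ0.ne', ENNReal.rpow_one]
  simp_rw [e] at h
  rw [one_div β, ENNReal.le_rpow_inv_iff hβ0, ← one_div]
  exact h

/-- Dual Rényi bound for one noisy step with a subsampled index: the two families of centres
are uniformly close except at the index `j`. -/
lemma coinLaw_dual_le {n : ℕ} [NeZero n] {v : ℝ≥0} {M α β : ℝ} (hM : 0 < M) (hMv : M ^ 2 ≤ v)
    (hαβ : α.HolderConjugate β) (hαv : α * (M ^ 2 / v) ≤ 1 / 288)
    {μ μ' : Fin n → EuclideanSpace ℝ ι} (j : Fin n)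
    (hne : ∀ i, i ≠ j → ‖μ i - μ' i‖ ≤ 1 / n * M)
    (hj : ∀ i, ‖μ j - μ' i‖ ≤ M / 2) (hj' : ∀ i, ‖μ' j - μ' i‖ ≤ M / 2)
    {g : EuclideanSpace ℝ ι → ℝ≥0∞} (hg : Measurable g) :
    ∫⁻ ξ, g (μ ξ.1 + ξ.2) ∂(coinLaw n ι v) ≤
      ENNReal.ofReal (Real.exp (renyiConst * α * (1 / n) ^ 2 * (M ^ 2 / v))) *
        (∫⁻ ξ, g (μ' ξ.1 + ξ.2) ^ β ∂(coinLaw n ι v)) ^ (1 / β) := by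
  have hn1 : 1 ≤ n := NeZero.one_le
  have hC := renyiConst_pos
  have hα := hαβ.pos
  rw [lintegral_coinLaw n v μ hg, lintegral_coinLaw n v μ' (g := fun y => g y ^ β) (by fun_prop)]
  set I : Fin n → ℝ≥0∞ := fun i => ∫⁻ y, g (μ i + y) ∂(isoGaussian ι v) with hI
  set I' : Fin n → ℝ≥0∞ := fun i => ∫⁻ y, g (μ' i + y) ^ β ∂(isoGaussian ι v) with hI'
  change ENNReal.ofReal (1 / n) * ∑ i, I i ≤ _ * (ENNReal.ofReal (1 / n) * ∑ i, I' i) ^ (1 / β)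
  -- For n = 1 there is no other index to pair with, and 1/n exceeds 1/2. Two equal centres of
  -- weight 1/2 are used instead; then the centres must be within M/2, which is why `hj` asks for
  -- M/2.
  rcases hn1.eq_or_lt with rfl | hn2
  · have h := mixture_dual_le (q := 1 / 2) hM hMv (by norm_num) le_rfl hαβ hαv
      (a := μ j) (a' := μ' j) (b := μ j) (b' := μ' j) (by linarith [hj j])
      (by linarith [hj j]) (by simpa using hM.le) hg
    have e : ∀ x : ℝ≥0∞, ENNReal.ofReal (1 - 1 / 2) * x + ENNReal.ofReal (1 / 2) * x = x := fun x => by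
      rw [← add_mul, ← ENNReal.ofReal_add (by norm_num) (by norm_num)]; norm_num
    rw [e, e] at h
    simp only [Fintype.sum_subsingleton _ j, Nat.cast_one, div_one, ENNReal.ofReal_one, one_mul]
    refine h.trans ?_
    gcongr
    norm_num
  · have hn0 : (0 : ℝ) < n := by positivity
    have hn2' : (2 : ℝ) ≤ n := by exact_mod_cast hn2
    have hq2 : 1 / (n : ℝ) ≤ 1 / 2 := one_div_le_one_div_of_le (by norm_num) hn2'
    have hpos : (0 : ℝ) < n - 1 := by linarith
    set s := Finset.univ.erase j with hs
    have hcard : (s.card : ℝ≥0∞) = ENNReal.ofReal ((n : ℝ) - 1) := by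
      rw [hs, Finset.card_erase_of_mem (Finset.mem_univ j), Finset.card_univ, Fintype.card_fin,
        ← ENNReal.ofReal_natCast, Nat.cast_sub hn1, Nat.cast_one]
    set w : ℝ≥0∞ := ENNReal.ofReal (1 / ((n : ℝ) - 1)) with hw
    have hsw : ∑ _k ∈ s, w = 1 := by
      rw [Finset.sum_const, nsmul_eq_mul, hcard, hw, ← ENNReal.ofReal_mul hpos.le,
        mul_one_div_cancel hpos.ne', ENNReal.ofReal_one]
    -- The uniform mixture is the average, over the n - 1 indices k ≠ j, of the two-point mixtures
    -- of k and j with weights 1 - 1/n and 1/n.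
    have hsplit : ∀ A : Fin n → ℝ≥0∞, ENNReal.ofReal (1 / n) * ∑ i, A i =
        ∑ k ∈ s, w * (ENNReal.ofReal (1 - 1 / n) * A k + ENNReal.ofReal (1 / n) * A j) := by
      intro A
      have e1 : w * ENNReal.ofReal (1 - 1 / n) = ENNReal.ofReal (1 / n) := by
        rw [hw, ← ENNReal.ofReal_mul (by positivity)]
        congr 1; field_simp
      simp_rw [mul_add, ← mul_assoc, e1]
      rw [Finset.sum_add_distrib, ← Finset.mul_sum, ← Finset.sum_mul, ← Finset.sum_mul, hsw, one_mul,
        ← mul_add, hs, Finset.sum_erase_add _ _ (Finset.mem_univ j)]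
    rw [hsplit I, hsplit I']
    calc _ ≤ ∑ k ∈ s, w * (ENNReal.ofReal (Real.exp (renyiConst * α * (1 / n) ^ 2 * (M ^ 2 / v))) *
            (ENNReal.ofReal (1 - 1 / n) * I' k + ENNReal.ofReal (1 / n) * I' j) ^ (1 / β)) := by
          refine Finset.sum_le_sum fun k hk => ?_
          gcongr
          exact mixture_dual_le hM hMv (by positivity) hq2 hαβ hαv
            (hne k (Finset.ne_of_mem_erase hk)) (by linarith [hj k]) (by linarith [hj' k]) hg
      _ = ENNReal.ofReal (Real.exp (renyiConst * α * (1 / n) ^ 2 * (M ^ 2 / v))) * ∑ k ∈ s, w *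
            (ENNReal.ofReal (1 - 1 / n) * I' k + ENNReal.ofReal (1 / n) * I' j) ^ (1 / β) := by
          rw [Finset.mul_sum]
          exact Finset.sum_congr rfl fun k _ => by ring
      _ ≤ _ := by
          gcongr
          exact sum_mul_rpow_inv_le s (fun _ => w) _ hsw hαβ.symm.lt.le

end Subsampling

/-! ### Adaptive composition and conversion to approximate privacy. -/

section Composition

/-- `Z` is a measurable function of finitely many coordinates, all of them in `J`. -/
def AdaptedTo {I Ξ S : Type*} [MeasurableSpace Ξ] [MeasurableSpace S] (J : Set I)
    (Z : (I → Ξ) → S) : Prop :=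
  ∃ J' : Finset I, ↑J' ⊆ J ∧ ∃ F : (J' → Ξ) → S, Measurable F ∧ ∀ ω, Z ω = F (J'.restrict ω)

/-- Dual (Hölder) form of a bound on the Rényi divergence between the laws of `Z` and `Z'`. -/
def DualClose {Ω S : Type*} [MeasurableSpace Ω] [MeasurableSpace S] (P : Measure Ω) (β : ℝ)
    (B : ℝ≥0∞) (Z Z' : Ω → S) : Prop :=
  ∀ g : S → ℝ≥0∞, Measurable g → ∫⁻ ω, g (Z ω) ∂P ≤ B * (∫⁻ ω, g (Z' ω) ^ β ∂P) ^ (1 / β)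

variable {I Ξ S S' : Type*} [MeasurableSpace Ξ] [MeasurableSpace S] [MeasurableSpace S']

lemma AdaptedTo.measurable {J : Set I} {Z : (I → Ξ) → S} (h : AdaptedTo J Z) : Measurable Z := by
  obtain ⟨J', -, F, hF, e⟩ := h
  rw [show Z = fun ω => F (J'.restrict ω) from funext e]
  exact hF.comp (Finset.measurable_restrict J')

lemma AdaptedTo.mono {J K : Set I} {Z : (I → Ξ) → S} (h : AdaptedTo J Z) (hJK : J ⊆ K) :
    AdaptedTo K Z := by
  obtain ⟨J', hJ', F, hF, e⟩ := h
  exact ⟨J', hJ'.trans hJK, F, hF, e⟩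

lemma adaptedTo_const (J : Set I) (z : S) : AdaptedTo J (fun _ : I → Ξ => z) :=
  ⟨∅, by simp, fun _ => z, measurable_const, fun _ => rfl⟩

lemma AdaptedTo.comp {J : Set I} {Z : (I → Ξ) → S} (h : AdaptedTo J Z) {Φ : S → S'}
    (hΦ : Measurable Φ) : AdaptedTo J (fun ω => Φ (Z ω)) := by
  obtain ⟨J', hJ', F, hF, e⟩ := h
  exact ⟨J', hJ', Φ ∘ F, hΦ.comp hF, fun ω => by simp [e]⟩

lemma AdaptedTo.step {J : Set I} {Z : (I → Ξ) → S} (h : AdaptedTo J Z) {e : I} {T : S × Ξ → S'}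
    (hT : Measurable T) : AdaptedTo (insert e J) (fun ω => T (Z ω, ω e)) := by
  classical
  obtain ⟨J', hJ', F, hF, h⟩ := h
  refine ⟨insert e J', by simpa using Set.insert_subset_insert hJ',
    fun y => T (F fun i => y ⟨i, Finset.mem_insert_of_mem i.2⟩, y ⟨e, Finset.mem_insert_self e J'⟩),
    by fun_prop, fun ω => by simp only [h]; rfl⟩

variable {κ : Measure Ξ} [IsProbabilityMeasure κ]

/-- The coin e is independent of the finitely many coins that determine Z, so Tonelli applies to the
joint law. -/
lemma AdaptedTo.lintegral_step {J : Set I} {Z : (I → Ξ) → S} (h : AdaptedTo J Z) {e : I}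
    (he : e ∉ J) {f : S × Ξ → ℝ≥0∞} (hf : Measurable f) :
    ∫⁻ ω, f (Z ω, ω e) ∂(Measure.infinitePi fun _ => κ) =
      ∫⁻ ω, ∫⁻ ξ, f (Z ω, ξ) ∂κ ∂(Measure.infinitePi fun _ => κ) := by
  classical
  have hZ := h.measurable
  obtain ⟨J', hJ', F, hF, h⟩ := h
  set P : Measure (I → Ξ) := Measure.infinitePi fun _ => κ with hP
  have hind : iIndepFun (fun (i : I) (ω : I → Ξ) => ω i) P :=
    iIndepFun_infinitePi (X := fun _ x => x) (fun _ => measurable_id)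
  have hdis : Disjoint J' {e} := by
    rw [Finset.disjoint_singleton_right]; exact fun h' => he (hJ' h')
  have h2 := (hind.indepFun_finset J' {e} hdis (fun i => measurable_pi_apply i)).comp hF
    (measurable_pi_apply (⟨e, Finset.mem_singleton_self e⟩ : ({e} : Finset I)))
  have h3 : IndepFun Z (fun ω => ω e) P := by
    have e1 : Z = F ∘ fun a i => a i := funext h
    rw [e1]; exact h2
  have h4 : P.map (fun ω => (Z ω, ω e)) = (P.map Z).prod κ := by
    rw [(indepFun_iff_map_prod_eq_prod_map_map hZ.aemeasurable
      (measurable_pi_apply e).aemeasurable).1 h3]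
    congr 1
    exact Measure.infinitePi_map_eval (fun _ => κ) e
  have hm : Measurable fun ω : I → Ξ => (Z ω, ω e) := hZ.prodMk (measurable_pi_apply e)
  rw [← lintegral_map hf hm, h4, lintegral_prod _ hf.aemeasurable,
    lintegral_map hf.lintegral_prod_right' hZ]

lemma DualClose.comp {Ω : Type*} [MeasurableSpace Ω] {P : Measure Ω} {β : ℝ} {B : ℝ≥0∞}
    {Z Z' : Ω → S} (h : DualClose P β B Z Z') {Φ : S → S'} (hΦ : Measurable Φ) :
    DualClose P β B (fun ω => Φ (Z ω)) (fun ω => Φ (Z' ω)) :=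
  fun g hg => h (g ∘ Φ) (hg.comp hΦ)

/-- Adaptive composition: the bounds multiply. -/
lemma DualClose.step {J : Set I} {Z Z' : (I → Ξ) → S} {β : ℝ} (hβ : 0 < β) {B B₁ : ℝ≥0∞}
    (hZ : AdaptedTo J Z) (hZ' : AdaptedTo J Z')
    (h : DualClose (Measure.infinitePi fun _ => κ) β B Z Z') {e : I} (he : e ∉ J)
    {T T' : S × Ξ → S'} (hT : Measurable T) (hT' : Measurable T')
    (hstep : ∀ s, DualClose κ β B₁ (fun ξ => T (s, ξ)) (fun ξ => T' (s, ξ))) :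
    DualClose (Measure.infinitePi fun _ => κ) β (B * B₁)
      (fun ω => T (Z ω, ω e)) (fun ω => T' (Z' ω, ω e)) := by
  intro g hg
  have hmT' : Measurable fun p => g (T' p) ^ β := by fun_prop
  rw [hZ.lintegral_step (f := fun p => g (T p)) he (by fun_prop),
    hZ'.lintegral_step (f := fun p => g (T' p) ^ β) he hmT']
  -- The one-step bound turns g into this test function of the state; raising it to the power β
  -- undoes the root, so the bound for Z, Z' applied to it closes the argument.
  set G : S → ℝ≥0∞ := fun s => (∫⁻ ξ, g (T' (s, ξ)) ^ β ∂κ) ^ (1 / β) with hG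
  have hGm : Measurable G := by
    have := hmT'.lintegral_prod_right' (ν := κ)
    exact this.pow_const _
  have hGβ : ∀ s, G s ^ β = ∫⁻ ξ, g (T' (s, ξ)) ^ β ∂κ := fun s => by
    rw [hG]
    simp only
    rw [← ENNReal.rpow_mul, one_div, inv_mul_cancel₀ hβ.ne', ENNReal.rpow_one]
  calc _ ≤ ∫⁻ ω, B₁ * G (Z ω) ∂(Measure.infinitePi fun _ => κ) :=
        lintegral_mono fun ω => hstep (Z ω) g hg
    _ = B₁ * ∫⁻ ω, G (Z ω) ∂(Measure.infinitePi fun _ => κ) :=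
        lintegral_const_mul _ (hGm.comp hZ.measurable)
    _ ≤ B₁ * (B * (∫⁻ ω, G (Z' ω) ^ β ∂(Measure.infinitePi fun _ => κ)) ^ (1 / β)) := by
        gcongr; exact h G hGm
    _ = _ := by simp_rw [hGβ]; ring

lemma dualClose_const {Ω : Type*} [MeasurableSpace Ω] {P : Measure Ω} [IsProbabilityMeasure P]
    {β : ℝ} (hβ : 0 < β) (z : S) : DualClose P β 1 (fun _ => z) (fun _ => z) := by
  intro g _
  simp only [lintegral_const, measure_univ, mul_one, one_mul]
  rw [← ENNReal.rpow_mul, mul_one_div_cancel hβ.ne', ENNReal.rpow_one]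

/-- From a dual Rényi bound to approximate differential privacy. -/
lemma DualClose.measure_le {Ω : Type*} [MeasurableSpace Ω] {P : Measure Ω} [IsProbabilityMeasure P]
    {α β E ε δ : ℝ} (hαβ : α.HolderConjugate β) {Z Z' : Ω → S} (hZ : Measurable Z)
    (hZ' : Measurable Z')
    (h : DualClose P β (ENNReal.ofReal (Real.exp E)) Z Z')
    (hE : Real.exp (α * E - (α - 1) * ε) ≤ δ) {A : Set S} (hA : MeasurableSet A) :
    P {ω | Z ω ∈ A} ≤ ENNReal.ofReal (Real.exp ε) * P {ω | Z' ω ∈ A} + ENNReal.ofReal δ := by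
  have hα := hαβ.pos
  have hβ := hαβ.symm.pos
  have h1 := h (A.indicator 1) (measurable_one.indicator hA)
  have e1 : ∀ Y : Ω → S, Measurable Y → ∫⁻ ω, A.indicator (1 : S → ℝ≥0∞) (Y ω) ∂P = P {ω | Y ω ∈ A} :=
    fun Y hY => by
      have := lintegral_indicator_one (μ := P) (hY hA)
      rw [← show Y ⁻¹' A = {ω | Y ω ∈ A} from rfl, ← this]
      rfl
  have e2 : ∀ s, A.indicator (1 : S → ℝ≥0∞) s ^ β = A.indicator 1 s := fun s => by
    by_cases hs : s ∈ A <;> simp [hs, hβ]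
  simp_rw [e2] at h1
  rw [e1 Z hZ, e1 Z' hZ'] at h1
  have hfin : P {ω | Z' ω ∈ A} ≠ ⊤ := measure_ne_top _ _
  set Q : ℝ := (P {ω | Z' ω ∈ A}).toReal with hQ
  have hQ0 : 0 ≤ Q := ENNReal.toReal_nonneg
  have hPQ : P {ω | Z' ω ∈ A} = ENNReal.ofReal Q := (ENNReal.ofReal_toReal hfin).symm
  rw [hPQ, ENNReal.ofReal_rpow_of_nonneg hQ0 (by positivity), ← ENNReal.ofReal_mul (by positivity)] at h1
  have hδ : 0 ≤ δ := (Real.exp_pos _).le.trans hE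
  rw [hPQ, ← ENNReal.ofReal_mul (by positivity), ← ENNReal.ofReal_add (by positivity) hδ]
  refine h1.trans (ENNReal.ofReal_le_ofReal ?_)
  have hβ' : 1 / β = 1 - 1 / α := by
    have := hαβ.inv_add_inv_eq_one
    rw [one_div, one_div]; linarith
  have hα1 : 0 < α - 1 := by linarith [hαβ.lt]
  have hβp : 0 < 1 / β := by positivity
  -- At this threshold e^E Q^(1/β) equals e^ε Q. Below it the left side is at most exp(αE - (α -
  -- 1)ε) ≤ δ; above it the multiplicative term alone suffices.
  rcases le_or_gt Q (Real.exp (α * (E - ε))) with hQe | hQe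
  · have h2 : Q ^ (1 / β) ≤ Real.exp (α * (E - ε)) ^ (1 / β) := by gcongr
    rw [← Real.exp_mul] at h2
    have h3 : Real.exp E * Q ^ (1 / β) ≤ δ := by
      calc _ ≤ Real.exp E * Real.exp (α * (E - ε) * (1 / β)) := by gcongr
        _ = Real.exp (α * E - (α - 1) * ε) := by
            rw [← Real.exp_add, hβ']; congr 1; field_simp; ring
        _ ≤ δ := hE
    have : 0 ≤ Real.exp ε * Q := by positivity
    linarith
  · have hQpos : 0 < Q := (Real.exp_pos _).trans hQe
    have h2 : Real.exp (E - ε) ≤ Q ^ (1 / α) := by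
      calc Real.exp (E - ε) = Real.exp (α * (E - ε)) ^ (1 / α) := by
            rw [← Real.exp_mul]; congr 1; field_simp
        _ ≤ _ := by gcongr
    have h3 : Q ^ (1 / β) * Q ^ (1 / α) = Q := by
      rw [← Real.rpow_add hQpos, hβ']; simp
    have h4 : Real.exp E * Q ^ (1 / β) ≤ Real.exp ε * Q := by
      calc Real.exp E * Q ^ (1 / β) = Real.exp ε * (Q ^ (1 / β) * Real.exp (E - ε)) := by
            rw [show E = ε + (E - ε) by ring, Real.exp_add]; ring_nf
        _ ≤ Real.exp ε * (Q ^ (1 / β) * Q ^ (1 / α)) := by gcongr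
        _ = _ := by rw [h3]
    linarith

end Composition

/-! ### Existence, nonexpansiveness and invariance of the proximal map. -/

section Prox

variable {p : ℕ} {C : Set (EuclideanSpace ℝ (Fin p))} {ρ : EuclideanSpace ℝ (Fin p) → ℝ}

/-- A convex lower semicontinuous function is bounded below by a linear function of the distance. -/
lemma exists_linear_lower_bound (hC : IsClosed C) (hρ : ConvexOn ℝ C ρ)
    (hl : LowerSemicontinuousOn ρ C) {x₀ : EuclideanSpace ℝ (Fin p)} (hx₀ : x₀ ∈ C) :
    ∃ K : ℝ, ∀ w ∈ C, -K * (1 + ‖w - x₀‖) ≤ ρ w := by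
  have hK : IsCompact (C ∩ Metric.closedBall x₀ 1) := (isCompact_closedBall x₀ 1).inter_left hC
  have hKne : (C ∩ Metric.closedBall x₀ 1).Nonempty :=
    ⟨x₀, hx₀, Metric.mem_closedBall_self zero_le_one⟩
  obtain ⟨a, -, hamin⟩ := (hl.mono Set.inter_subset_left).exists_isMinOn hKne hK
  have hlow : ∀ w ∈ C, ‖w - x₀‖ ≤ 1 → -|ρ a| ≤ ρ w := fun w hw h1 =>
    (neg_abs_le _).trans (hamin ⟨hw, by rwa [mem_closedBall_iff_norm]⟩)
  refine ⟨|ρ a| + |ρ x₀|, fun w hw => ?_⟩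
  have ha := abs_nonneg (ρ a)
  have h0 := abs_nonneg (ρ x₀)
  have hn := norm_nonneg (w - x₀)
  rcases le_or_gt ‖w - x₀‖ 1 with h | h
  · have := hlow w hw h
    nlinarith
  · set R := ‖w - x₀‖ with hR
    have hRpos : 0 < R := by linarith
    have hle : 1 / R ≤ 1 := by rw [div_le_one hRpos]; exact h.le
    have hconv := hρ.2 hx₀ hw (by linarith : 0 ≤ 1 - 1 / R) (by positivity : 0 ≤ 1 / R) (by ring)
    have hmem := hρ.1 hx₀ hw (by linarith : 0 ≤ 1 - 1 / R) (by positivity : 0 ≤ 1 / R) (by ring)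
    have hnorm : ‖(1 - 1 / R) • x₀ + (1 / R) • w - x₀‖ ≤ 1 := by
      rw [show (1 - 1 / R) • x₀ + (1 / R) • w - x₀ = (1 / R) • (w - x₀) by module, norm_smul,
        Real.norm_of_nonneg (by positivity), ← hR, one_div_mul_cancel hRpos.ne']
    have h1 := hlow _ hmem hnorm
    simp only [smul_eq_mul] at hconv
    have h2 := mul_le_mul_of_nonneg_left (h1.trans hconv) hRpos.le
    have e : R * ((1 - 1 / R) * ρ x₀ + 1 / R * ρ w) = (R - 1) * ρ x₀ + ρ w := by
      field_simp
    rw [e] at h2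
    nlinarith [le_abs_self (ρ x₀)]

/-- The quadratic dominates the linear lower bound of ρ, so minimization may be restricted to a
compact ball, where lower semicontinuity gives a minimizer. -/
lemma exists_prox (hC : IsClosed C) (hρ : ConvexOn ℝ C ρ) (hl : LowerSemicontinuousOn ρ C)
    (hne : C.Nonempty) (y : EuclideanSpace ℝ (Fin p)) :
    ∃ x ∈ C, IsMinOn (fun w => ‖w - y‖ ^ 2 / 2 + ρ w) C x := by
  obtain ⟨x₀, hx₀⟩ := hne
  obtain ⟨K, hK⟩ := exists_linear_lower_bound hC hρ hl hx₀
  set Φ : EuclideanSpace ℝ (Fin p) → ℝ := fun w => ‖w - y‖ ^ 2 / 2 + ρ w with hΦ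
  have hΦl : LowerSemicontinuousOn Φ C := by
    have hc : ContinuousOn (fun w : EuclideanSpace ℝ (Fin p) => ‖w - y‖ ^ 2 / 2) C := by fun_prop
    exact hc.lowerSemicontinuousOn.add hl
  set b := ‖x₀ - y‖ with hb
  -- outside of a ball the objective exceeds its value at `x₀`
  obtain ⟨R, hR0, hR⟩ : ∃ R : ℝ, 0 ≤ R ∧ ∀ s, R ≤ s → Φ x₀ ≤ (s - b) ^ 2 / 2 - K * (1 + s) := by
    refine ⟨b + 2 * |K| + 2 + |Φ x₀ + K * (1 + b)|, by positivity, fun s hs => ?_⟩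
    have h1 := le_abs_self (Φ x₀ + K * (1 + b))
    have h2 := le_abs_self K
    have h3 := abs_nonneg (Φ x₀ + K * (1 + b))
    have h4 := abs_nonneg K
    set d := s - b with hd
    have hd' : 2 * |K| + 2 + |Φ x₀ + K * (1 + b)| ≤ d := by linarith
    have e : s = d + b := by ring
    rw [e]
    nlinarith [mul_nonneg (by linarith : 0 ≤ d) (by linarith : 0 ≤ |K| - K)]
  have hfar : ∀ w ∈ C, R ≤ ‖w - x₀‖ → Φ x₀ ≤ Φ w := by
    intro w hw hRw
    refine (hR _ hRw).trans ?_
    have h1 := hK w hw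
    have h2 : |‖w - x₀‖ - b| ≤ ‖w - y‖ := by
      have := abs_norm_sub_norm_le (w - x₀) (y - x₀)
      rw [norm_sub_rev y x₀, sub_sub_sub_cancel_right] at this
      exact this
    have h3 : (‖w - x₀‖ - b) ^ 2 ≤ ‖w - y‖ ^ 2 := by
      rw [← sq_abs]; gcongr
    simp only [hΦ]
    linarith
  have hcomp : IsCompact (C ∩ Metric.closedBall x₀ R) := (isCompact_closedBall x₀ R).inter_left hC
  have hcne : (C ∩ Metric.closedBall x₀ R).Nonempty :=
    ⟨x₀, hx₀, Metric.mem_closedBall_self hR0⟩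
  obtain ⟨x, hx, hxmin⟩ := (hΦl.mono Set.inter_subset_left).exists_isMinOn hcne hcomp
  refine ⟨x, hx.1, fun w hw => ?_⟩
  rcases le_or_gt ‖w - x₀‖ R with h | h
  · exact hxmin ⟨hw, by rwa [mem_closedBall_iff_norm]⟩
  · exact (hxmin ⟨hx₀, Metric.mem_closedBall_self hR0⟩ : Φ x ≤ Φ x₀).trans (hfar w hw h.le)

lemma prox_mem {y : EuclideanSpace ℝ (Fin p)}
    (h : ∃ x ∈ C, IsMinOn (fun w => ‖w - y‖ ^ 2 / 2 + ρ w) C x) : prox C ρ y ∈ C := by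
  rw [prox, dif_pos h]; exact h.choose_spec.1

lemma prox_isMinOn {y : EuclideanSpace ℝ (Fin p)}
    (h : ∃ x ∈ C, IsMinOn (fun w => ‖w - y‖ ^ 2 / 2 + ρ w) C x) :
    IsMinOn (fun w => ‖w - y‖ ^ 2 / 2 + ρ w) C (prox C ρ y) := by
  rw [prox, dif_pos h]; exact h.choose_spec.2

/-- The variational inequality of the minimizer: compare x with (1 - t)x + tw, divide by t and take
t small. -/
lemma inner_le_of_isMinOn (hρ : ConvexOn ℝ C ρ) {x y w : EuclideanSpace ℝ (Fin p)} (hx : x ∈ C)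
    (hmin : IsMinOn (fun w => ‖w - y‖ ^ 2 / 2 + ρ w) C x) (hw : w ∈ C) :
    ⟪y - x, w - x⟫ ≤ ρ w - ρ x := by
  have key : ∀ t : ℝ, 0 < t → t ≤ 1 → ⟪y - x, w - x⟫ ≤ ρ w - ρ x + t * (‖w - x‖ ^ 2 / 2) := by
    intro t ht ht1
    have hmem := hρ.1 hx hw (by linarith : 0 ≤ 1 - t) ht.le (by ring)
    have h1 : ‖x - y‖ ^ 2 / 2 + ρ x ≤ ‖(1 - t) • x + t • w - y‖ ^ 2 / 2 +
      ρ ((1 - t) • x + t • w) := hmin hmem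
    have h2 := hρ.2 hx hw (by linarith : 0 ≤ 1 - t) ht.le (by ring)
    simp only [smul_eq_mul] at h2
    rw [show (1 - t) • x + t • w - y = t • (w - x) - (y - x) by module,
      norm_sub_sq_real (t • (w - x)), norm_smul, Real.norm_of_nonneg ht.le, real_inner_smul_left,
      real_inner_comm, norm_sub_rev x y] at h1
    have h3 : t * ⟪y - x, w - x⟫ ≤ t * (ρ w - ρ x + t * (‖w - x‖ ^ 2 / 2)) := by nlinarith
    exact le_of_mul_le_mul_left h3 ht
  by_contra! hlt
  set c := ‖w - x‖ ^ 2 / 2 with hc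
  have hc0 : 0 ≤ c := by positivity
  set d := ⟪y - x, w - x⟫ - (ρ w - ρ x) with hd
  have hd0 : 0 < d := by linarith
  have ht1 : d / (d + c + 1) ≤ 1 := by rw [div_le_one (by linarith)]; linarith
  have := key (d / (d + c + 1)) (by positivity) ht1
  have h5 : d / (d + c + 1) * c < d := by
    rw [div_mul_eq_mul_div, div_lt_iff₀ (by linarith)]; nlinarith
  linarith

/-- Firm nonexpansiveness: add the variational inequalities of the two minimizers, each tested at
the other. It yields both the measurability of the proximal map and `prox_congr`. -/
lemma norm_sq_le_of_isMinOn (hρ : ConvexOn ℝ C ρ) {x₁ x₂ y₁ y₂ : EuclideanSpace ℝ (Fin p)}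
    (hx₁ : x₁ ∈ C) (hx₂ : x₂ ∈ C)
    (h₁ : IsMinOn (fun w => ‖w - y₁‖ ^ 2 / 2 + ρ w) C x₁)
    (h₂ : IsMinOn (fun w => ‖w - y₂‖ ^ 2 / 2 + ρ w) C x₂) :
    ‖x₁ - x₂‖ ^ 2 ≤ ⟪y₁ - y₂, x₁ - x₂⟫ := by
  have e1 := inner_le_of_isMinOn hρ hx₁ h₁ hx₂
  have e2 := inner_le_of_isMinOn hρ hx₂ h₂ hx₁
  rw [← real_inner_self_eq_norm_sq]
  have e3 : ⟪y₁ - x₁, x₂ - x₁⟫ + ⟪y₂ - x₂, x₁ - x₂⟫ =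
      ⟪x₁ - x₂, x₁ - x₂⟫ - ⟪y₁ - y₂, x₁ - x₂⟫ := by
    rw [← neg_sub x₁ x₂, inner_neg_right]
    simp only [inner_sub_left]
    ring
  linarith

lemma lipschitzWith_prox (hC : IsClosed C) (hρ : ConvexOn ℝ C ρ) (hl : LowerSemicontinuousOn ρ C)
    (hne : C.Nonempty) : LipschitzWith 1 (prox C ρ) := by
  refine LipschitzWith.of_dist_le_mul fun y₁ y₂ => ?_
  have e₁ := exists_prox hC hρ hl hne y₁
  have e₂ := exists_prox hC hρ hl hne y₂
  have h := norm_sq_le_of_isMinOn hρ (prox_mem e₁) (prox_mem e₂) (prox_isMinOn e₁) (prox_isMinOn e₂)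
  have h2 := h.trans (real_inner_le_norm _ _)
  rw [dist_eq_norm, dist_eq_norm, NNReal.coe_one, one_mul]
  rcases (norm_nonneg (prox C ρ y₁ - prox C ρ y₂)).eq_or_lt with h0 | h0
  · rw [← h0]; positivity
  · rw [pow_two] at h2
    exact le_of_mul_le_mul_right h2 h0

/-- The proximal operator only sees the component of its argument along the span of `C`. -/
lemma prox_congr (hC : IsClosed C) (hρ : ConvexOn ℝ C ρ) (hl : LowerSemicontinuousOn ρ C)
    (hne : C.Nonempty) {y₁ y₂ : EuclideanSpace ℝ (Fin p)} (h : y₁ - y₂ ∈ (vectorSpan ℝ C)ᗮ) :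
    prox C ρ y₁ = prox C ρ y₂ := by
  have e₁ := exists_prox hC hρ hl hne y₁
  have e₂ := exists_prox hC hρ hl hne y₂
  have h1 := norm_sq_le_of_isMinOn hρ (prox_mem e₁) (prox_mem e₂) (prox_isMinOn e₁) (prox_isMinOn e₂)
  have hv : prox C ρ y₁ - prox C ρ y₂ ∈ vectorSpan ℝ C :=
    vsub_mem_vectorSpan ℝ (prox_mem e₁) (prox_mem e₂)
  rw [real_inner_comm, (Submodule.mem_orthogonal _ _).1 h _ hv] at h1
  have : ‖prox C ρ y₁ - prox C ρ y₂‖ = 0 := by nlinarith [norm_nonneg (prox C ρ y₁ - prox C ρ y₂)]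
  exact sub_eq_zero.1 (norm_eq_zero.1 this)

end Prox

/-! ### Tangential bound on gradients of functions Lipschitz on C. -/

section Gradient

variable {p : ℕ} {C : Set (EuclideanSpace ℝ (Fin p))}

lemma exists_relative_ball (hC : Convex ℝ C) (hne : C.Nonempty) :
    ∃ x₀ ∈ C, ∃ R > 0, ∀ v ∈ vectorSpan ℝ C, ‖v‖ < R → x₀ + v ∈ C := by
  obtain ⟨x₀, hx₀⟩ := hne.intrinsicInterior hC
  obtain ⟨y, hy, rfl⟩ := mem_intrinsicInterior.1 hx₀
  rw [mem_interior_iff_mem_nhds, Metric.mem_nhds_iff] at hy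
  obtain ⟨R, hR, hball⟩ := hy
  refine ⟨y, intrinsicInterior_subset hx₀, R, hR, fun v hv hvR => ?_⟩
  have hmem : v +ᵥ (y : EuclideanSpace ℝ (Fin p)) ∈ affineSpan ℝ C :=
    AffineSubspace.vadd_mem_of_mem_direction (by rwa [direction_affineSpan]) y.2
  have : (⟨v +ᵥ (y : EuclideanSpace ℝ (Fin p)), hmem⟩ : affineSpan ℝ C) ∈ Metric.ball y R := by
    rw [Metric.mem_ball, Subtype.dist_eq, dist_eq_norm]
    simpa using hvR
  have h2 := hball this
  rw [add_comm]
  exact h2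

lemma inner_gradient_le {h : EuclideanSpace ℝ (Fin p) → ℝ} {G : ℝ}
    (hG : ∀ x ∈ C, ∀ y ∈ C, |h x - h y| ≤ G * ‖x - y‖) {x v : EuclideanSpace ℝ (Fin p)}
    (hd : DifferentiableAt ℝ h x) {τ : ℝ} (hτ : 0 < τ)
    (hseg : ∀ t, 0 ≤ t → t ≤ τ → x + t • v ∈ C) : ⟪gradient h x, v⟫ ≤ G * ‖v‖ := by
  have h1 : HasDerivAt (fun t : ℝ => h (x + t • v)) ⟪gradient h x, v⟫ 0 := by
    have hl : HasDerivAt (fun t : ℝ => x + t • v) v 0 := by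
      simpa using ((hasDerivAt_id (0 : ℝ)).smul_const v).const_add x
    have hg : HasFDerivAt h (InnerProductSpace.toDual ℝ _ (gradient h x)) (x + (0 : ℝ) • v) := by
      rw [zero_smul, add_zero]; exact hd.hasGradientAt.hasFDerivAt
    exact hg.comp_hasDerivAt (0 : ℝ) hl
  have h2 := h1.hasDerivWithinAt (s := Set.Ioi 0)
  rw [hasDerivWithinAt_iff_tendsto_slope' (by simp)] at h2
  refine le_of_tendsto h2 ?_
  filter_upwards [Ioc_mem_nhdsGT hτ] with t ht
  have h3 := hG _ (hseg t ht.1.le ht.2) _ (hseg 0 le_rfl hτ.le)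
  rw [slope_def_field, sub_zero, div_le_iff₀ ht.1]
  refine (le_abs_self _).trans (h3.trans_eq ?_)
  rw [show x + t • v - (x + (0 : ℝ) • v) = t • v by module, norm_smul, Real.norm_of_nonneg ht.1.le]
  ring

/-- A function that is Lipschitz on a convex set `C`, with continuous gradient on `C`,
has a gradient whose component along the span of `C` is bounded by the Lipschitz constant. -/
lemma norm_starProjection_gradient_le (hC : Convex ℝ C) {h : EuclideanSpace ℝ (Fin p) → ℝ} {G L : ℝ}
    (hG0 : 0 ≤ G) (hd : ∀ x ∈ C, DifferentiableAt ℝ h x)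
    (hG : ∀ x ∈ C, ∀ y ∈ C, |h x - h y| ≤ G * ‖x - y‖)
    (hL : ∀ x ∈ C, ∀ y ∈ C, ‖gradient h x - gradient h y‖ ≤ L * ‖x - y‖)
    {x : EuclideanSpace ℝ (Fin p)} (hx : x ∈ C) :
    ‖(vectorSpan ℝ C).starProjection (gradient h x)‖ ≤ G := by
  obtain ⟨x₀, hx₀, R, hR, hball⟩ := exists_relative_ball hC ⟨x, hx⟩
  have hsmall : ∀ v ∈ vectorSpan ℝ C, ‖v‖ < R → ⟪gradient h x, v⟫ ≤ G * ‖v‖ := by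
    intro v hv hvR
    have key : ∀ t : ℝ, 0 < t → t ≤ 1 →
        ⟪gradient h x, v⟫ ≤ G * ‖v‖ + t * (L * ‖x - x₀‖ * ‖v‖) := by
      intro t ht ht1
      -- At a boundary point x not every tangent direction is admissible. Moving slightly towards
      -- the relative interior point x₀ makes room for v, and the Lipschitz gradient carries the
      -- bound back to x as t → 0.
      set xt := (1 - t) • x + t • x₀ with hxt
      have hxtC : xt ∈ C := hC hx hx₀ (by linarith) ht.le (by ring)
      have h1 : ⟪gradient h xt, v⟫ ≤ G * ‖v‖ := by
        refine inner_gradient_le hG (hd xt hxtC) ht fun τ hτ hτt => ?_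
        have hmem : x₀ + (τ / t) • v ∈ C := by
          refine hball _ (Submodule.smul_mem _ _ hv) (lt_of_le_of_lt ?_ hvR)
          rw [norm_smul, Real.norm_of_nonneg (by positivity)]
          exact mul_le_of_le_one_left (norm_nonneg v) ((div_le_one ht).2 hτt)
        have := hC hx hmem (by linarith : 0 ≤ 1 - t) ht.le (by ring)
        have e : xt + τ • v = (1 - t) • x + t • (x₀ + (τ / t) • v) := by
          rw [hxt, smul_add, smul_smul, mul_div_cancel₀ _ ht.ne', add_assoc]
        rwa [e]
      have h2 : ⟪gradient h x - gradient h xt, v⟫ ≤ L * ‖x - xt‖ * ‖v‖ :=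
        (real_inner_le_norm _ _).trans (by gcongr; exact hL x hx xt hxtC)
      rw [inner_sub_left, show x - xt = t • (x - x₀) by rw [hxt]; module, norm_smul,
        Real.norm_of_nonneg ht.le] at h2
      linarith
    set c := L * ‖x - x₀‖ * ‖v‖ with hc
    have ht : Filter.Tendsto (fun t : ℝ => G * ‖v‖ + t * c) (nhdsWithin 0 (Set.Ioi 0))
        (nhds (G * ‖v‖ + 0 * c)) := by
      apply Filter.Tendsto.mono_left _ nhdsWithin_le_nhds
      exact (by fun_prop : Continuous fun t : ℝ => G * ‖v‖ + t * c).tendsto 0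
    rw [zero_mul, add_zero] at ht
    refine ge_of_tendsto ht ?_
    filter_upwards [Ioc_mem_nhdsGT zero_lt_one] with t ht
    exact key t ht.1 ht.2
  set u := (vectorSpan ℝ C).starProjection (gradient h x) with hu
  have huV : u ∈ vectorSpan ℝ C := Submodule.starProjection_apply_mem _ _
  have huu : ⟪gradient h x, u⟫ = ‖u‖ ^ 2 := by
    have h1 : ⟪gradient h x - u, u⟫ = 0 :=
      Submodule.starProjection_inner_eq_zero (gradient h x) u huV
    rw [inner_sub_left, real_inner_self_eq_norm_sq] at h1
    linarith
  rcases (norm_nonneg u).eq_or_lt with h0 | h0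
  · rw [← h0]; exact hG0
  -- Rescales the projection u to length R/2, so that it is an admissible direction to test against.
  set a := R / (2 * ‖u‖) with ha
  have ha0 : 0 < a := by positivity
  have hau : ‖a • u‖ = R / 2 := by
    rw [norm_smul, Real.norm_of_nonneg ha0.le, ha]; field_simp
  have h3 := hsmall (a • u) (Submodule.smul_mem _ _ huV) (by rw [hau]; linarith)
  rw [norm_smul, Real.norm_of_nonneg ha0.le, real_inner_smul_right, huu] at h3
  have h4 : (a * ‖u‖) * ‖u‖ ≤ (a * ‖u‖) * G := by linarith
  exact le_of_mul_le_mul_left h4 (by positivity)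

end Gradient

/-- The assumptions on the constraint set, the regularizer and the losses. -/
structure RegularProblem {p : ℕ} {X : Type*} (f : EuclideanSpace ℝ (Fin p) → X → ℝ)
    (C : Set (EuclideanSpace ℝ (Fin p))) (r : EuclideanSpace ℝ (Fin p) → ℝ) (G L : ℝ) : Prop where
  isClosed : IsClosed C
  convex : Convex ℝ C
  convexOn : ConvexOn ℝ C r
  lsc : LowerSemicontinuousOn r C
  G_pos : 0 < G
  differentiableAt : ∀ z, ∀ x ∈ C, DifferentiableAt ℝ (fun w => f w z) x
  lipschitz : ∀ z, ∀ x ∈ C, ∀ y ∈ C, |f x z - f y z| ≤ G * ‖x - y‖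
  gradLipschitz : ∀ z, ∀ x ∈ C, ∀ y ∈ C, ‖lossGrad f x z - lossGrad f y z‖ ≤ L * ‖x - y‖

/-! ### Sensitivity of one step, and composition over the epochs. -/

section Algorithm

variable {p n : ℕ} {X : Type*}

/-- The component along the span of `C` of the gradient of the loss, extended by zero outside `C`. -/
def tangentGrad (f : EuclideanSpace ℝ (Fin p) → X → ℝ) (C : Set (EuclideanSpace ℝ (Fin p)))
    (z : X) (x : EuclideanSpace ℝ (Fin p)) : EuclideanSpace ℝ (Fin p) :=
  C.indicator (fun x => (vectorSpan ℝ C).starProjection (lossGrad f x z)) x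

/-- The component along the span of `C` of the noiseless variance-reduced gradient. -/
def tangentMean (f : EuclideanSpace ℝ (Fin p) → X → ℝ) (C : Set (EuclideanSpace ℝ (Fin p)))
    (D : Fin n → X) (xt x : EuclideanSpace ℝ (Fin p)) (i : Fin n) : EuclideanSpace ℝ (Fin p) :=
  tangentGrad f C (D i) x - tangentGrad f C (D i) xt + (n : ℝ)⁻¹ • ∑ k, tangentGrad f C (D k) xt

/-- The update of (snapshot, iterate, running sum of the iterates) caused by a noisy gradient. -/
def epochUpdate (C : Set (EuclideanSpace ℝ (Fin p))) (r : EuclideanSpace ℝ (Fin p) → ℝ) (η : ℝ)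
    (q : (EuclideanSpace ℝ (Fin p) × EuclideanSpace ℝ (Fin p) × EuclideanSpace ℝ (Fin p)) ×
      EuclideanSpace ℝ (Fin p)) :
    EuclideanSpace ℝ (Fin p) × EuclideanSpace ℝ (Fin p) × EuclideanSpace ℝ (Fin p) :=
  (q.1.1, prox C (fun w => η * r w) (q.1.2.1 - η • q.2),
    q.1.2.2 + prox C (fun w => η * r w) (q.1.2.1 - η • q.2))

/-- One step of an epoch, on (snapshot, iterate, running sum of the iterates) and one coin. -/
def epochStep (f : EuclideanSpace ℝ (Fin p) → X → ℝ) (C : Set (EuclideanSpace ℝ (Fin p)))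
    (r : EuclideanSpace ℝ (Fin p) → ℝ) (η : ℝ) (D : Fin n → X)
    (q : (EuclideanSpace ℝ (Fin p) × EuclideanSpace ℝ (Fin p) × EuclideanSpace ℝ (Fin p)) ×
      (Fin n × EuclideanSpace ℝ (Fin p))) :
    EuclideanSpace ℝ (Fin p) × EuclideanSpace ℝ (Fin p) × EuclideanSpace ℝ (Fin p) :=
  epochUpdate C r η (q.1, tangentMean f C D q.1.1 q.1.2.1 q.2.1 + q.2.2)

variable {f : EuclideanSpace ℝ (Fin p) → X → ℝ} {C : Set (EuclideanSpace ℝ (Fin p))}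
  {r : EuclideanSpace ℝ (Fin p) → ℝ} {G L η : ℝ}

lemma RegularProblem.norm_tangentGrad_le (h : RegularProblem f C r G L) (z : X)
    (x : EuclideanSpace ℝ (Fin p)) : ‖tangentGrad f C z x‖ ≤ G := by
  by_cases hx : x ∈ C
  · rw [tangentGrad, Set.indicator_of_mem hx]
    exact norm_starProjection_gradient_le h.convex h.G_pos.le (h.differentiableAt z)
      (h.lipschitz z) (h.gradLipschitz z) hx
  · rw [tangentGrad, Set.indicator_of_notMem hx, norm_zero]; exact h.G_pos.le

/-- The gradient is continuous on the closed set C and uncontrolled elsewhere; the extension by zero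
makes it Borel on the whole space. -/
lemma RegularProblem.measurable_tangentGrad (h : RegularProblem f C r G L) (z : X) :
    Measurable (tangentGrad f C z) := by
  classical
  have hl : LipschitzOnWith L.toNNReal (fun x => lossGrad f x z) C := by
    refine LipschitzOnWith.of_dist_le_mul fun x hx y hy => ?_
    rw [dist_eq_norm, dist_eq_norm]
    exact (h.gradLipschitz z x hx y hy).trans (by gcongr; exact Real.le_coe_toNNReal L)
  have hc : ContinuousOn (fun x => (vectorSpan ℝ C).starProjection (lossGrad f x z)) C :=
    (vectorSpan ℝ C).starProjection.continuous.comp_continuousOn hl.continuousOn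
  have := hc.measurable_piecewise (g := 0) continuousOn_const h.isClosed.measurableSet
  rwa [Set.piecewise_eq_indicator] at this

lemma RegularProblem.measurable_tangentMean (h : RegularProblem f C r G L) (D : Fin n → X) :
    Measurable fun q : (EuclideanSpace ℝ (Fin p) × EuclideanSpace ℝ (Fin p)) × Fin n =>
      tangentMean f C D q.1.1 q.1.2 q.2 := by
  refine measurable_from_prod_countable_left fun i => ?_
  have hx : Measurable fun x : EuclideanSpace ℝ (Fin p) × EuclideanSpace ℝ (Fin p) =>
    tangentGrad f C (D i) x.2 := (h.measurable_tangentGrad (D i)).comp measurable_snd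
  have hxt : ∀ k, Measurable fun x : EuclideanSpace ℝ (Fin p) × EuclideanSpace ℝ (Fin p) =>
    tangentGrad f C (D k) x.1 := fun k => (h.measurable_tangentGrad (D k)).comp measurable_fst
  simp only [tangentMean]
  fun_prop

lemma RegularProblem.convexOn_smul (h : RegularProblem f C r G L) (hη : 0 < η) :
    ConvexOn ℝ C (fun w => η * r w) := h.convexOn.smul hη.le

lemma RegularProblem.lsc_smul (h : RegularProblem f C r G L) (hη : 0 < η) :
    LowerSemicontinuousOn (fun w => η * r w) C :=
  (continuous_const_mul η).comp_lowerSemicontinuousOn h.lsc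
    (fun _ _ hab => mul_le_mul_of_nonneg_left hab hη.le)

lemma RegularProblem.prox_mem (h : RegularProblem f C r G L) (hη : 0 < η) (hne : C.Nonempty)
    (y : EuclideanSpace ℝ (Fin p)) : prox C (fun w => η * r w) y ∈ C :=
  DPERM.prox_mem (exists_prox h.isClosed (h.convexOn_smul hη) (h.lsc_smul hη) hne y)

lemma RegularProblem.measurable_epochUpdate (h : RegularProblem f C r G L) (hη : 0 < η)
    (hne : C.Nonempty) : Measurable (epochUpdate C r η) := by
  have := (lipschitzWith_prox h.isClosed (h.convexOn_smul hη)
    (h.lsc_smul hη) hne).continuous.measurable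
  unfold epochUpdate
  fun_prop

lemma RegularProblem.measurable_epochStep (h : RegularProblem f C r G L) (hη : 0 < η)
    (hne : C.Nonempty) (D : Fin n → X) : Measurable (epochStep f C r η D) := by
  have hq : Measurable fun q : (EuclideanSpace ℝ (Fin p) × EuclideanSpace ℝ (Fin p) ×
      EuclideanSpace ℝ (Fin p)) × (Fin n × EuclideanSpace ℝ (Fin p)) =>
        ((q.1.1, q.1.2.1), q.2.1) := by fun_prop
  have h1 : Measurable fun q : (EuclideanSpace ℝ (Fin p) × EuclideanSpace ℝ (Fin p) ×
      EuclideanSpace ℝ (Fin p)) × (Fin n × EuclideanSpace ℝ (Fin p)) =>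
        tangentMean f C D q.1.1 q.1.2.1 q.2.1 := by
    have := Measurable.comp (h.measurable_tangentMean D) hq
    simpa only [Function.comp_def] using this
  have h2 : Measurable fun q : (EuclideanSpace ℝ (Fin p) × EuclideanSpace ℝ (Fin p) ×
      EuclideanSpace ℝ (Fin p)) × (Fin n × EuclideanSpace ℝ (Fin p)) => q.2.2 := by fun_prop
  exact (h.measurable_epochUpdate hη hne).comp (measurable_fst.prodMk (h1.add h2))

/-- Sensitivity of the mean gradient at indices other than the changed record. -/
lemma RegularProblem.norm_tangentMean_sub_le (h : RegularProblem f C r G L) {D D' : Fin n → X}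
    {j : Fin n} (hD : ∀ i, i ≠ j → D i = D' i) (xt x : EuclideanSpace ℝ (Fin p)) {i : Fin n}
    (hi : i ≠ j) :
    ‖tangentMean f C D xt x i - tangentMean f C D' xt x i‖ ≤ 1 / n * (12 * G) := by
  have e : tangentMean f C D xt x i - tangentMean f C D' xt x i =
      (n : ℝ)⁻¹ • (tangentGrad f C (D j) xt - tangentGrad f C (D' j) xt) := by
    rw [tangentMean, tangentMean, hD i hi, add_sub_add_left_eq_sub, ← smul_sub,
      ← Finset.sum_sub_distrib, Finset.sum_eq_single j]
    · intro k _ hk; rw [hD k hk, sub_self]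
    · simp
  rw [e, norm_smul, Real.norm_of_nonneg (by positivity), one_div]
  have h1 := (norm_sub_le _ _).trans
    (add_le_add (h.norm_tangentGrad_le (D j) xt) (h.norm_tangentGrad_le (D' j) xt))
  have := h.G_pos
  gcongr
  linarith

lemma RegularProblem.norm_tangentMean_le [NeZero n] (h : RegularProblem f C r G L) (D : Fin n → X)
    (xt x : EuclideanSpace ℝ (Fin p)) (i : Fin n) : ‖tangentMean f C D xt x i‖ ≤ 3 * G := by
  have hn : (0 : ℝ) < n := by exact_mod_cast NeZero.pos n
  have h1 := (norm_sub_le _ _).trans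
    (add_le_add (h.norm_tangentGrad_le (D i) x) (h.norm_tangentGrad_le (D i) xt))
  have h2 : ‖(n : ℝ)⁻¹ • ∑ k, tangentGrad f C (D k) xt‖ ≤ G := by
    rw [norm_smul, Real.norm_of_nonneg (by positivity), inv_mul_le_iff₀ hn]
    refine (norm_sum_le _ _).trans ((Finset.sum_le_sum fun k _ => h.norm_tangentGrad_le (D k) xt).trans_eq ?_)
    simp
  exact (norm_add_le _ _).trans (by linarith)

/-- Dual Rényi bound for one step of the algorithm. -/
lemma RegularProblem.dualClose_epochStep [NeZero n] (h : RegularProblem f C r G L) (hη : 0 < η)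
    (hne : C.Nonempty) {D D' : Fin n → X} (hD : Neighbor D D') {v : ℝ≥0} {α β : ℝ}
    (hαβ : α.HolderConjugate β) (hv : (12 * G) ^ 2 ≤ v) (hαv : α * ((12 * G) ^ 2 / v) ≤ 1 / 288)
    (s : EuclideanSpace ℝ (Fin p) × EuclideanSpace ℝ (Fin p) × EuclideanSpace ℝ (Fin p)) :
    DualClose (coinLaw n (Fin p) v) β
      (ENNReal.ofReal (Real.exp (renyiConst * α * (1 / n) ^ 2 * ((12 * G) ^ 2 / v))))
      (fun ξ => epochStep f C r η D (s, ξ)) (fun ξ => epochStep f C r η D' (s, ξ)) := by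
  obtain ⟨j, hj⟩ := hD
  intro g hg
  have hG := h.G_pos
  have hm := h.measurable_epochUpdate hη hne
  have hdiff : ∀ (D D' : Fin n → X) (i k : Fin n),
      ‖tangentMean f C D s.1 s.2.1 i - tangentMean f C D' s.1 s.2.1 k‖ ≤ 12 * G / 2 := fun D D' i k =>
    (norm_sub_le _ _).trans (by
      have h1 := h.norm_tangentMean_le D s.1 s.2.1 i
      have h2 := h.norm_tangentMean_le D' s.1 s.2.1 k
      linarith)
  -- Here M = 12G: each mean has norm at most 3G, so any two are within 6G = M/2.
  exact coinLaw_dual_le (μ := tangentMean f C D s.1 s.2.1) (μ' := tangentMean f C D' s.1 s.2.1)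
    (by linarith) hv hαβ hαv j (fun i hi => h.norm_tangentMean_sub_le hj s.1 s.2.1 hi)
    (fun i => hdiff D D' j i) (fun i => hdiff D' D' j i)
    (g := fun y => g (epochUpdate C r η (s, y))) (by fun_prop)

/-- Inside `C` the projected update agrees with the update of the algorithm. -/
lemma RegularProblem.prox_tangentMean (h : RegularProblem f C r G L) (hη : 0 < η) (D : Fin n → X)
    {xt x : EuclideanSpace ℝ (Fin p)} (hxt : xt ∈ C) (hx : x ∈ C)
    (ξ : Fin n × EuclideanSpace ℝ (Fin p)) :
    prox C (fun w => η * r w) (x - η • (tangentMean f C D xt x ξ.1 + ξ.2)) =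
      prox C (fun w => η * r w) (x - η • noisyGrad f D xt x ξ) := by
  refine prox_congr h.isClosed (h.convexOn_smul hη) (h.lsc_smul hη) ⟨x, hx⟩ ?_
  set g := lossGrad f x (D ξ.1) - lossGrad f xt (D ξ.1) + riskGrad f D xt with hg
  have e1 : tangentMean f C D xt x ξ.1 = (vectorSpan ℝ C).starProjection g := by
    simp only [tangentMean, tangentGrad, Set.indicator_of_mem hx, Set.indicator_of_mem hxt, hg,
      riskGrad, map_add, map_sub, map_smul, map_sum]
  have e2 : x - η • (tangentMean f C D xt x ξ.1 + ξ.2) - (x - η • noisyGrad f D xt x ξ) =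
      η • (g - (vectorSpan ℝ C).starProjection g) := by
    rw [e1, noisyGrad, ← hg]; module
  rw [e2]
  exact Submodule.smul_mem _ _ (Submodule.sub_starProjection_mem_orthogonal g)

lemma RegularProblem.epochIter_mem (h : RegularProblem f C r G L) (hη : 0 < η) (D : Fin n → X)
    {xt x0 : EuclideanSpace ℝ (Fin p)} (hx0 : x0 ∈ C) (ξ : ℕ → Fin n × EuclideanSpace ℝ (Fin p))
    (t : ℕ) : epochIter f C r η D xt x0 ξ t ∈ C := by
  cases t with
  | zero => exact hx0
  | succ t => exact h.prox_mem hη ⟨x0, hx0⟩ _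

/-- The state after `t` steps of an epoch: snapshot, iterate, running sum of the iterates. -/
def epochTrace (f : EuclideanSpace ℝ (Fin p) → X → ℝ) (C : Set (EuclideanSpace ℝ (Fin p)))
    (r : EuclideanSpace ℝ (Fin p) → ℝ) (η : ℝ) (D : Fin n → X)
    (q : EuclideanSpace ℝ (Fin p) × EuclideanSpace ℝ (Fin p))
    (ξ : ℕ → Fin n × EuclideanSpace ℝ (Fin p)) (t : ℕ) :
    EuclideanSpace ℝ (Fin p) × EuclideanSpace ℝ (Fin p) × EuclideanSpace ℝ (Fin p) :=
  (q.1, epochIter f C r η D q.1 q.2 ξ t, ∑ k ∈ Finset.Icc 1 t, epochIter f C r η D q.1 q.2 ξ k)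

/-- Carrying the running sum makes the state Markov: a step depends on the previous state and one
fresh coin only, as `DualClose.step` requires. Membership in C is what lets projected gradients
replace the true ones. -/
lemma RegularProblem.epochTrace_succ (h : RegularProblem f C r G L) (hη : 0 < η) (D : Fin n → X)
    {q : EuclideanSpace ℝ (Fin p) × EuclideanSpace ℝ (Fin p)} (h1 : q.1 ∈ C) (h2 : q.2 ∈ C)
    (ξ : ℕ → Fin n × EuclideanSpace ℝ (Fin p)) (t : ℕ) :
    epochTrace f C r η D q ξ (t + 1) =
      epochStep f C r η D (epochTrace f C r η D q ξ t, ξ (t + 1)) := by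
  have e := h.prox_tangentMean hη D h1 (h.epochIter_mem hη D (xt := q.1) h2 ξ t) (ξ (t + 1))
  simp only [epochTrace, epochStep, epochUpdate, e, Finset.sum_Icc_succ_top (Nat.le_add_left 1 t)]
  rfl

lemma RegularProblem.svrgppState_mem (h : RegularProblem f C r G L) (hη : 0 < η) {m : ℕ}
    (hm : 0 < m) {xinit : EuclideanSpace ℝ (Fin p)} (hx : xinit ∈ C) (D : Fin n → X)
    (ω : ℕ × ℕ → Fin n × EuclideanSpace ℝ (Fin p)) (s : ℕ) :
    (svrgppState f C r η m xinit D ω s).1 ∈ C ∧ (svrgppState f C r η m xinit D ω s).2 ∈ C := by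
  induction s with
  | zero => exact ⟨hx, hx⟩
  | succ s ih =>
    have hmem := h.epochIter_mem hη D (xt := (svrgppState f C r η m xinit D ω s).1) ih.2
      (fun t => ω (s + 1, t))
    refine ⟨?_, hmem _⟩
    change ((2 ^ (s + 1) * m : ℕ) : ℝ)⁻¹ • ∑ k ∈ Finset.Icc 1 (2 ^ (s + 1) * m), _ ∈ C
    rw [Finset.smul_sum]
    have hM : ((2 ^ (s + 1) * m : ℕ) : ℝ) ≠ 0 := by positivity
    refine h.convex.sum_mem (fun _ _ => by positivity) ?_ (fun k _ => hmem k)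
    rw [Finset.sum_const, Nat.card_Icc, Nat.add_sub_cancel, nsmul_eq_mul, mul_inv_cancel₀ hM]

/-- Coupling invariant: `Z` and `Z'` use coins in `J` only and are close. -/
def AdaptedClose {n p : ℕ} [NeZero n] {S : Type*} [MeasurableSpace S] (v : ℝ≥0) (β B : ℝ) (N : ℕ)
    (J : Set (ℕ × ℕ)) (Z Z' : (ℕ × ℕ → Fin n × EuclideanSpace ℝ (Fin p)) → S) : Prop :=
  AdaptedTo J Z ∧ AdaptedTo J Z' ∧
    DualClose (Measure.infinitePi fun _ => coinLaw n (Fin p) v) β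
      (ENNReal.ofReal (Real.exp (N * B))) Z Z'

/-- Induction over epochs, with an inner induction over steps. Each step uses a coin not used before
and costs one factor exp B; initializing the running sum and averaging at the end of an epoch are
post-processing and cost nothing. -/
lemma RegularProblem.adaptedClose_svrgppState [NeZero n] (h : RegularProblem f C r G L)
    (hη : 0 < η) {m : ℕ} (hm : 0 < m) {xinit : EuclideanSpace ℝ (Fin p)} (hx : xinit ∈ C)
    {D D' : Fin n → X} (hD : Neighbor D D') {v : ℝ≥0} {α β : ℝ}
    (hαβ : α.HolderConjugate β) (hv : (12 * G) ^ 2 ≤ v) (hαv : α * ((12 * G) ^ 2 / v) ≤ 1 / 288)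
    (s : ℕ) :
    AdaptedClose v β (renyiConst * α * (1 / n) ^ 2 * ((12 * G) ^ 2 / v))
      (∑ k ∈ Finset.range s, 2 ^ (k + 1) * m) {e | e.1 ≤ s}
      (fun ω => svrgppState f C r η m xinit D ω s)
      (fun ω => svrgppState f C r η m xinit D' ω s) := by
  set B := renyiConst * α * (1 / n) ^ 2 * ((12 * G) ^ 2 / v) with hB
  have hβ := hαβ.symm.pos
  have hne : C.Nonempty := ⟨xinit, hx⟩
  induction s with
  | zero =>
    refine ⟨adaptedTo_const _ _, adaptedTo_const _ _, ?_⟩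
    have := dualClose_const (P := Measure.infinitePi fun _ : ℕ × ℕ => coinLaw n (Fin p) v) hβ
      (xinit, xinit)
    simpa [svrgppState] using this
  | succ s ih =>
    have inner : ∀ t : ℕ, AdaptedClose v β B ((∑ k ∈ Finset.range s, 2 ^ (k + 1) * m) + t)
        {e | e.1 ≤ s ∨ (e.1 = s + 1 ∧ e.2 ≤ t)}
        (fun ω => epochTrace f C r η D (svrgppState f C r η m xinit D ω s)
          (fun t => ω (s + 1, t)) t)
        (fun ω => epochTrace f C r η D' (svrgppState f C r η m xinit D' ω s)
          (fun t => ω (s + 1, t)) t) := by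
      intro t
      induction t with
      | zero =>
        have hΦ : Measurable fun q : EuclideanSpace ℝ (Fin p) × EuclideanSpace ℝ (Fin p) =>
          (q.1, q.2, (0 : EuclideanSpace ℝ (Fin p))) := by fun_prop
        exact ⟨(ih.1.comp hΦ).mono fun e he => Or.inl he, (ih.2.1.comp hΦ).mono fun e he => Or.inl he,
          ih.2.2.comp hΦ⟩
      | succ t iht =>
        obtain ⟨a1, a2, a3⟩ := iht
        have hsub : insert (s + 1, t + 1) {e : ℕ × ℕ | e.1 ≤ s ∨ (e.1 = s + 1 ∧ e.2 ≤ t)} ⊆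
            {e | e.1 ≤ s ∨ (e.1 = s + 1 ∧ e.2 ≤ t + 1)} := by
          rintro e (rfl | he | he)
          · simp
          · exact Or.inl he
          · exact Or.inr ⟨he.1, he.2.trans (Nat.le_succ t)⟩
        have e1 : ∀ D : Fin n → X, (fun ω => epochTrace f C r η D (svrgppState f C r η m xinit D ω s)
            (fun t => ω (s + 1, t)) (t + 1)) = fun ω => epochStep f C r η D
            (epochTrace f C r η D (svrgppState f C r η m xinit D ω s)
              (fun t => ω (s + 1, t)) t, ω (s + 1, t + 1)) := fun D => by
          funext ω
          have := h.svrgppState_mem hη hm hx D ω s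
          exact h.epochTrace_succ hη D this.1 this.2 _ t
        rw [e1 D, e1 D']
        have m1 := h.measurable_epochStep hη hne D
        have m2 := h.measurable_epochStep hη hne D'
        refine ⟨(a1.step m1).mono hsub, (a2.step m2).mono hsub, ?_⟩
        have := DualClose.step hβ a1 a2 a3 (e := (s + 1, t + 1)) (by simp) m1 m2
          (h.dualClose_epochStep hη hne hD hαβ hv hαv)
        rw [← ENNReal.ofReal_mul (Real.exp_pos _).le, ← Real.exp_add] at this
        rwa [show (((∑ k ∈ Finset.range s, 2 ^ (k + 1) * m) + (t + 1) : ℕ) : ℝ) * B =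
          (((∑ k ∈ Finset.range s, 2 ^ (k + 1) * m) + t : ℕ) : ℝ) * B + B by push_cast; ring]
    obtain ⟨a1, a2, a3⟩ := inner (2 ^ (s + 1) * m)
    have hΦ : Measurable fun q : EuclideanSpace ℝ (Fin p) × EuclideanSpace ℝ (Fin p) ×
        EuclideanSpace ℝ (Fin p) => (((2 ^ (s + 1) * m : ℕ) : ℝ)⁻¹ • q.2.2, q.2.1) := by fun_prop
    have hsub : {e : ℕ × ℕ | e.1 ≤ s ∨ (e.1 = s + 1 ∧ e.2 ≤ 2 ^ (s + 1) * m)} ⊆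
        {e | e.1 ≤ s + 1} := by
      rintro e (he | he)
      · exact Nat.le_succ_of_le he
      · exact he.1.le
    rw [Finset.sum_range_succ]
    exact ⟨(a1.comp hΦ).mono hsub, (a2.comp hΦ).mono hsub, a3.comp hΦ⟩

lemma coins_eq_infinitePi [NeZero n] (σ : ℝ) :
    coins n p σ = Measure.infinitePi fun _ => coinLaw n (Fin p) (σ ^ 2).toNNReal := by
  simp only [coins, coinLaw, multivariateGaussian_eq_isoGaussian]

lemma sum_range_epoch_le (T m : ℕ) :
    ((∑ k ∈ Finset.range T, 2 ^ (k + 1) * m : ℕ) : ℝ) ≤ 2 * (2 ^ T * m) := by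
  have h : ∑ k ∈ Finset.range T, 2 ^ (k + 1) * m + 2 * m = 2 * (2 ^ T * m) := by
    induction T with
    | zero => simp
    | succ T ih =>
      rw [Finset.sum_range_succ, add_right_comm, ih]; ring
  exact_mod_cast Nat.le.intro h

end Algorithm

end DPERM

end

/-! ### Choice of the order α and of the constants. -/

theorem theorem4p3 (A : ℝ) (hA : 0 < A) :
    ∃ c₁ c : ℝ, 0 < c₁ ∧ 0 < c ∧
      ∀ (p n : ℕ) [NeZero n] (X : Type*)
        (C : Set (EuclideanSpace ℝ (Fin p)))
        (f : EuclideanSpace ℝ (Fin p) → X → ℝ) (r : EuclideanSpace ℝ (Fin p) → ℝ)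
        (G L η : ℝ) (xinit : EuclideanSpace ℝ (Fin p)) (T m : ℕ) (ε δ σ : ℝ),
        IsClosed C → Convex ℝ C → xinit ∈ C →
        ConvexOn ℝ C r → LowerSemicontinuousOn r C →
        0 < G →
        (∀ z, ∀ x ∈ C, DifferentiableAt ℝ (fun w => f w z) x) →
        (∀ z, ∀ x ∈ C, ∀ y ∈ C, |f x z - f y z| ≤ G * ‖x - y‖) →
        (∀ z, ∀ x ∈ C, ∀ y ∈ C,
          ‖DPERM.lossGrad f x z - DPERM.lossGrad f y z‖ ≤ L * ‖x - y‖) →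
        0 < η →
        0 < ε → 0 < δ →
        ε ≤ c₁ * (2 ^ T * m / n ^ 2) →
        ε ≤ A * Real.log (2 / δ) →
        σ ^ 2 = c * (G ^ 2 * 2 ^ T * m * Real.log (2 / δ) / (n ^ 2 * ε ^ 2)) →
        DPERM.IsDP (DPERM.coins n p σ) (DPERM.dpSvrgpp f C r η T m xinit) ε δ := by
  have hK := DPERM.renyiConst_pos
  -- The 288 is 2 · 12², from the bound 2 · 2^T m on the number of steps and from M = 12G; A + 2
  -- comes from αε ≤ (A + 2)l. The choice of c₁ is what `hαv` needs.
  set c : ℝ := 288 * DPERM.renyiConst * (A + 2) ^ 2 with hc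
  have hcpos : 0 < c := by positivity
  set c₁ : ℝ := c / (144 * 288 * (A + 2)) with hc₁
  refine ⟨c₁, c, by positivity, hcpos, ?_⟩
  intro p n _ X C f r G L η xinit T m ε δ σ hC hconv hx hr hl hG hd hlip hgl hη hε hδ hε1 hε2 hσ
    D D' hD S hS
  have h : DPERM.RegularProblem f C r G L := ⟨hC, hconv, hr, hl, hG, hd, hlip, hgl⟩
  have hn : (0 : ℝ) < n := by exact_mod_cast NeZero.pos n
  -- Positivity of m is forced: m = 0 would give ε ≤ 0.
  have hm : 0 < m := by
    rcases Nat.eq_zero_or_pos m with rfl | hm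
    · simp at hε1; linarith
    · exact hm
  have hm' : (0 : ℝ) < m := by exact_mod_cast hm
  set l := Real.log (2 / δ) with hl'
  have hlpos : 0 < l := by
    by_contra! hneg
    nlinarith
  set K : ℝ := 2 ^ T * m with hKdef
  have hKpos : 0 < K := by positivity
  set v : NNReal := (σ ^ 2).toNNReal with hv
  have hvσ : (v : ℝ) = c * (G ^ 2 * K * l / (n ^ 2 * ε ^ 2)) := by
    rw [hv, Real.coe_toNNReal _ (sq_nonneg σ), hσ, hKdef]; ring
  have hratio : (12 * G) ^ 2 / (v : ℝ) = 144 * (n ^ 2 * ε ^ 2) / (c * K * l) := by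
    rw [hvσ]; field_simp; ring
  have hvpos : 0 < (v : ℝ) := by rw [hvσ]; positivity
  -- Makes (α - 1)ε = 2l: one l absorbs αE, the other gives exp(-l) = δ/2.
  set α := 1 + 2 * l / ε with hα
  have hα1 : 1 < α := by
    have : 0 < 2 * l / ε := by positivity
    linarith
  have hαle : α * ε ≤ (A + 2) * l := by
    rw [hα, add_mul, div_mul_cancel₀ _ hε.ne']; linarith
  have hαβ := Real.HolderConjugate.conjExponent hα1
  have hαv : α * ((12 * G) ^ 2 / v) ≤ 1 / 288 := by
    rw [hratio, mul_div_assoc', div_le_div_iff₀ (by positivity) (by norm_num)]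
    have h1 : ε * n ^ 2 * (144 * 288 * (A + 2)) ≤ c * K := by
      rw [hc₁, div_mul_div_comm, le_div_iff₀ (by positivity)] at hε1
      linarith
    calc α * (144 * (n ^ 2 * ε ^ 2)) * 288 = (α * ε) * (144 * 288 * (n ^ 2 * ε)) := by ring
      _ ≤ ((A + 2) * l) * (144 * 288 * (n ^ 2 * ε)) := by gcongr
      _ = (ε * n ^ 2 * (144 * 288 * (A + 2))) * l := by ring
      _ ≤ (c * K) * l := by gcongr
      _ = _ := by ring
  have hv12 : (12 * G) ^ 2 ≤ (v : ℝ) := by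
    have h0 : 0 ≤ (12 * G) ^ 2 / (v : ℝ) := by positivity
    have : (12 * G) ^ 2 / (v : ℝ) ≤ 1 := by nlinarith
    rwa [div_le_one hvpos] at this
  obtain ⟨a1, a2, a3⟩ := h.adaptedClose_svrgppState hη hm hx hD hαβ hv12 hαv T
  rw [DPERM.coins_eq_infinitePi]
  have a3' := a3.comp (measurable_fst (α := EuclideanSpace ℝ (Fin p)) (β := EuclideanSpace ℝ (Fin p)))
  refine a3'.measure_le hαβ (measurable_fst.comp a1.measurable) (measurable_fst.comp a2.measurable)
    ?_ hS
  have hsum := DPERM.sum_range_epoch_le T m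
  have hE : α * (((∑ k ∈ Finset.range T, 2 ^ (k + 1) * m : ℕ) : ℝ) *
      (DPERM.renyiConst * α * (1 / n) ^ 2 * ((12 * G) ^ 2 / v))) ≤ l := by
    calc _ ≤ α * ((2 * K) * (DPERM.renyiConst * α * (1 / n) ^ 2 * ((12 * G) ^ 2 / v))) := by
          gcongr
      _ = 288 * DPERM.renyiConst * (α * ε) ^ 2 / (c * l) := by
          rw [hratio]; field_simp; ring
      _ ≤ 288 * DPERM.renyiConst * ((A + 2) * l) ^ 2 / (c * l) := by gcongr
      _ = l := by rw [hc]; field_simp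
  have h2 : (α - 1) * ε = 2 * l := by rw [hα]; field_simp; ring
  calc _ ≤ Real.exp (-l) := by
        apply Real.exp_le_exp.2
        rw [h2]; linarith
    _ = δ / 2 := by rw [Real.exp_neg, hl', Real.exp_log (by positivity), inv_div]
    _ ≤ δ := by linarith
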